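/- Let $\widetilde{Gr}_2(\mathbb R^4)$ be the 4-manifold of oriented 2-planes in $\mathbb R^4$, i.e. the rank two $4\times 2$ matrices modulo the right action of $GL_+(2,\mathbb R)$; write $[\![A]\!]$ for the class of $A$. It is oriented so that the coordinates $(x_1,\dots,x_4)\mapsto\left[\!\left[\begin{smallmatrix}x_1&-x_4\\x_2&x_3\\1&0\\0&1\end{smallmatrix}\right]\!\right]$ are positively oriented. Let $S^2_\infty$ be the set of oriented planes contained in $\mathbb R^3\times\{0\}$, and let $TS^2$ be the set of classes of the matrices $\left(\begin{smallmatrix}t&-v\\0&1\end{smallmatrix}\right)$ with $t,v\in\mathbb R^3$, $|t|=1$, $\langle t,v\rangle=0$. Let $TD_\pm\subset TS^2$ be the part with $\pm t_3>0$, with coordinates $x^\pm\in\mathbb R^4$ given by $x^\pm\mapsto\left[\!\left[\begin{smallmatrix}\pm x_1^\pm&-x_4^\pm\\ \pm x_2^\pm&x_3^\pm\\ \pm1&0\\0&1\end{smallmatrix}\right]\!\right]$. Let $f_+,f_-:\mathbb R^2\to\mathbb R$ be smooth, compactly supported and $SO(2)$-invariant, with $f_-=-f_+$, and consider the (Petean)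 metrics $$g_\pm=2(dx_1^\pm dx_3^\pm+dx_2^\pm dx_4^\pm)+f_\pm(x_1^\pm,x_2^\pm)\left((dx_1^\pm)^2+(dx_2^\pm)^2\right)\quad\text{on } TD_\pm .$$ **Proposition.** One has $TS^2=\widetilde{Gr}_2(\mathbb R^4)-S^2_\infty$. There is a smooth metric $g$ of signature $(2,2)$ on $TS^2$ whose restriction to $TD_+$ is a positive multiple of $g_+$ and whose restriction to $TD_-$ is a positive multiple of $g_-$ (the multiples being functions). For every such $g$, the conformal structure $[g]$ is a singular self-dual conformal structure on $\widetilde{Gr}_2(\mathbb R^4)$ with singular $\beta$-surface $S^2_\infty$, that is: 1. $[g]$ is self-dual on $TS^2$ (the anti-self-dual part of its Weyl curvature vanishes). 2. $S^2_\infty$ is closed, and every point of $S^2_\infty$ has an open neighbourhood $U$ with positively oriented smooth coordinates $(u_1,u_2,u_3,u_4)$ such that $S^2_\infty\cap U=\{u_2=u_3=0\}$ and such that, with $u_2=r\cos\phi$, $u_3=r\sin\phi$, there are a positive smooth function $h$ on $U\setminus S^2_\infty$ and a smooth function $\rho(u_1,u_4,\phi)$ with $$hg=2(du_1du_3+du_2du_4)+\rho(u_1,u_4,\phi)\,r^2d\phi^2+E\quad\text{on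 } U\setminus S^2_\infty ,$$ where the components of the symmetric tensor $E$ in the coordinates $u$ tend to $0$ at every point of $S^2_\infty\cap U$. -/

import Mathlib

open Set Filter Topology
open scoped ContDiff Manifold Matrix

noncomputable section

/-! The oriented Grassmannian of 2-planes in `ℝ⁴`, as `4 × 2` matrices of rank two modulo the right
action of `GL₊(2, ℝ)`, with its smooth structure. -/

/-- Coordinate space. The coordinates written `(x₁, x₂, x₃, x₄)` are `(x 0, x 1, x 2, x 3)`. -/
abbrev R4 : Type := Fin 4 → ℝ

/-- `4 × 2` matrices of rank two: pairs of linearly independent vectors of `ℝ⁴`. -/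
abbrev Frame : Type := {A : Matrix (Fin 4) (Fin 2) ℝ // A.rank = 2}

/-- `A ∼ A P` for `P ∈ GL₊(2, ℝ)`. -/
def frameSetoid : Setoid Frame where
  r A B := ∃ P : Matrix (Fin 2) (Fin 2) ℝ, 0 < P.det ∧ B.1 = A.1 * P
  iseqv := by
    refine ⟨fun A => ⟨1, by simp, by simp⟩, ?_, ?_⟩
    · rintro A B ⟨P, hP, h⟩
      refine ⟨P⁻¹, ?_, ?_⟩
      · rw [Matrix.det_nonsing_inv, Ring.inverse_eq_inv']; positivity
      · rw [h, Matrix.mul_assoc, Matrix.mul_nonsing_inv _ (Ne.isUnit hP.ne'), Matrix.mul_one]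
    · rintro A B C ⟨P, hP, h⟩ ⟨Q, hQ, h'⟩
      exact ⟨P * Q, by rw [Matrix.det_mul]; positivity, by rw [h', h, Matrix.mul_assoc]⟩

/-- The Grassmannian of oriented 2-planes in `ℝ⁴`. -/
def OGr : Type := Quotient frameSetoid

instance : TopologicalSpace OGr := inferInstanceAs (TopologicalSpace (Quotient frameSetoid))

/-- The class `⟦A⟧` of a matrix of rank two. -/
def OGr.mk (A : Matrix (Fin 4) (Fin 2) ℝ) (h : A.rank = 2) : OGr := Quotient.mk frameSetoid ⟨A, h⟩

/-- The `2 × 2` minor of `A` on the rows `i`, `j`. -/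
def minor (A : Matrix (Fin 4) (Fin 2) ℝ) (i j : Fin 4) : ℝ := A i 0 * A j 1 - A i 1 * A j 0

theorem minor_mul (A : Matrix (Fin 4) (Fin 2) ℝ) (P : Matrix (Fin 2) (Fin 2) ℝ) (i j : Fin 4) :
    minor (A * P) i j = minor A i j * P.det := by
  simp only [minor, Matrix.mul_apply, Fin.sum_univ_two, Matrix.det_fin_two]; ring

theorem rank_eq_two_of_minor {A : Matrix (Fin 4) (Fin 2) ℝ} {i j : Fin 4} (h : minor A i j ≠ 0) :
    A.rank = 2 := by
  apply le_antisymm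
  · simpa using A.rank_le_width
  · have h1 := A.rank_submatrix_le ![i, j] id
    rw [Matrix.rank_of_isUnit (A.submatrix ![i, j] id)] at h1
    · simpa using h1
    · rw [Matrix.isUnit_iff_isUnit_det]
      apply Ne.isUnit
      rw [Matrix.det_fin_two]
      exact h

theorem exists_minor_ne_zero {A : Matrix (Fin 4) (Fin 2) ℝ} (h : A.rank = 2) :
    ∃ i j, minor A i j ≠ 0 := by
  by_contra! hc
  have hli : LinearIndependent ℝ A.col := by
    rw [linearIndependent_iff_card_eq_finrank_span, Set.finrank, ← Matrix.rank_eq_finrank_span_cols, h]; rfl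
  rw [Fintype.linearIndependent_iff] at hli
  simp only [minor] at hc
  by_cases ha : ∀ k, A k 0 = 0
  · have := hli ![1, 0] (by ext k; simp [Fin.sum_univ_two, ha]) 0
    simp at this
  · push Not at ha
    obtain ⟨k, hk⟩ := ha
    have := hli ![A k 1, - A k 0] (by
      ext l; simp [Fin.sum_univ_two]; linarith [hc k l]) 1
    simp at this
    exact hk this

/-- The affine family of planes spanned by `(u₁, u₂, 1, 0)` and `(-u₄, u₃, 0, 1)`. -/
def affineFrame (u : R4) : Matrix (Fin 4) (Fin 2) ℝ := !![u 0, -u 3; u 1, u 2; 1, 0; 0, 1]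

theorem minor_affineFrame (u : R4) : minor (affineFrame u) 2 3 = 1 := by
  simp [minor, affineFrame]

/-- The inverse of `affineFrame` in terms of minors. -/
def affineCoord (A : Matrix (Fin 4) (Fin 2) ℝ) : R4 :=
  ![minor A 0 3 / minor A 2 3, minor A 1 3 / minor A 2 3,
    minor A 2 1 / minor A 2 3, minor A 0 2 / minor A 2 3]

theorem affineCoord_affineFrame (u : R4) : affineCoord (affineFrame u) = u := by
  ext i; fin_cases i <;> simp [minor, affineFrame, affineCoord]

theorem affineCoord_mul (A : Matrix (Fin 4) (Fin 2) ℝ) {P : Matrix (Fin 2) (Fin 2) ℝ}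
    (hP : 0 < P.det) : affineCoord (A * P) = affineCoord A := by
  simp only [affineCoord, minor_mul, mul_div_mul_right _ _ hP.ne']

theorem affineFrame_affineCoord {A : Matrix (Fin 4) (Fin 2) ℝ} (h : minor A 2 3 ≠ 0) :
    affineFrame (affineCoord A) * !![A 2 0, A 2 1; A 3 0, A 3 1] = A := by
  ext i j
  fin_cases i <;> fin_cases j <;>
    simp [affineFrame, affineCoord, Matrix.mul_apply, Fin.sum_univ_two] <;> field_simp <;>
    simp only [minor] <;> ring

theorem continuous_minor (i j : Fin 4) : Continuous fun A : Frame => minor A.1 i j := by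
  have h : ∀ k l, Continuous fun A : Frame => A.1 k l := fun k l =>
    continuous_subtype_val.matrix_elem k l
  exact ((h i 0).mul (h j 1)).sub ((h i 1).mul (h j 0))

/-- The oriented planes spanned by the columns of some `affineFrame u`. -/
def baseSource : Set OGr := {x | Quotient.lift (fun A : Frame => 0 < minor A.1 2 3) (by
  rintro A B ⟨P, hP, h⟩; simp only [h, minor_mul, mul_pos_iff_of_pos_right hP]) x}

theorem isOpen_baseSource : IsOpen baseSource := by
  have hq : IsQuotientMap (Quotient.mk frameSetoid) := isQuotientMap_quot_mk
  refine hq.isOpen_preimage.1 (?_ : IsOpen {A : Frame | 0 < minor A.1 2 3})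
  exact isOpen_lt continuous_const (continuous_minor 2 3)

/-- The standard affine chart `[affineFrame u] ↦ u` of the Grassmannian. -/
def baseChart : OpenPartialHomeomorph OGr R4 where
  toFun := Quotient.lift (fun A : Frame => affineCoord A.1) (by
    rintro A B ⟨P, hP, h⟩; simp only [h, affineCoord_mul _ hP])
  invFun u := OGr.mk (affineFrame u)
    (rank_eq_two_of_minor (i := 2) (j := 3) (by simp [minor_affineFrame]))
  source := baseSource
  target := univ
  map_source' _ _ := mem_univ _
  map_target' u _ := by
    change 0 < minor (affineFrame u) 2 3
    rw [minor_affineFrame]; exact one_pos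
  left_inv' := by
    rintro ⟨A, hA⟩ h
    change 0 < minor A 2 3 at h
    refine Quotient.sound ⟨!![A 2 0, A 2 1; A 3 0, A 3 1], ?_,
      (affineFrame_affineCoord h.ne').symm⟩
    simpa [Matrix.det_fin_two, minor] using h
  right_inv' u _ := affineCoord_affineFrame u
  open_source := isOpen_baseSource
  open_target := isOpen_univ
  continuousOn_toFun := by
    have hq : IsQuotientMap (Quotient.mk frameSetoid) := isQuotientMap_quot_mk
    refine (hq.continuousOn_isOpen_iff isOpen_baseSource).2 ?_
    refine continuousOn_pi.2 fun i => ?_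
    have key : ∀ k l, ContinuousOn (fun A : Frame => minor A.1 k l / minor A.1 2 3)
        {A : Frame | 0 < minor A.1 2 3} := fun k l =>
      (continuous_minor k l).continuousOn.div (continuous_minor 2 3).continuousOn
        fun A hA => ne_of_gt hA
    fin_cases i
    exacts [key 0 3, key 1 3, key 2 1, key 0 2]
  continuousOn_invFun := by
    refine Continuous.continuousOn (continuous_quotient_mk'.comp (Continuous.subtype_mk ?_ _))
    refine continuous_matrix fun i j => ?_
    fin_cases i <;> fin_cases j <;> simp [affineFrame] <;> fun_prop

/-- The left action of an invertible matrix on the Grassmannian. -/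
def actFun (Q : GL (Fin 4) ℝ) : OGr → OGr :=
  Quotient.map' (fun A : Frame => ⟨Q.1 * A.1, by
    rw [Matrix.rank_mul_eq_right_of_isUnit_det _ _ ((Matrix.isUnit_iff_isUnit_det _).1 Q.isUnit)]
    exact A.2⟩) (by
    rintro A B ⟨P, hP, h⟩; exact ⟨P, hP, by simp only [h, Matrix.mul_assoc]⟩)

theorem continuous_actFun (Q : GL (Fin 4) ℝ) : Continuous (actFun Q) := by
  refine continuous_quot_lift _ (continuous_quotient_mk'.comp (Continuous.subtype_mk ?_ _))
  fun_prop

theorem actFun_actFun (Q R : GL (Fin 4) ℝ) (x : OGr) : actFun Q (actFun R x) = actFun (Q * R) x := by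
  obtain ⟨A, hA⟩ := x
  exact congrArg (Quotient.mk frameSetoid) (Subtype.ext (by simp [Matrix.mul_assoc]))

theorem actFun_one (x : OGr) : actFun 1 x = x := by
  obtain ⟨A, hA⟩ := x
  exact congrArg (Quotient.mk frameSetoid) (Subtype.ext (by simp))

/-- The left action of an invertible matrix, as a homeomorphism. -/
def actHomeo (Q : GL (Fin 4) ℝ) : OGr ≃ₜ OGr where
  toFun := actFun Q
  invFun := actFun Q⁻¹
  left_inv x := by rw [actFun_actFun, inv_mul_cancel, actFun_one]
  right_inv x := by rw [actFun_actFun, mul_inv_cancel, actFun_one]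
  continuous_toFun := continuous_actFun Q
  continuous_invFun := continuous_actFun Q⁻¹

/-- The affine chart whose inverse is `u ↦ [Q * affineFrame u]`. These charts form the atlas. -/
def affineChart (Q : GL (Fin 4) ℝ) : OpenPartialHomeomorph OGr R4 :=
  (actHomeo Q).symm.transOpenPartialHomeomorph baseChart

theorem exists_mem_affineChart_source (x : OGr) : ∃ Q, x ∈ (affineChart Q).source := by
  obtain ⟨A, hA⟩ := x
  have hmin : ∃ i j, 0 < minor A i j := by
    obtain ⟨i, j, h⟩ := exists_minor_ne_zero hA
    rcases h.lt_or_gt with h | h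
    · exact ⟨j, i, by simp only [minor] at h ⊢; linarith⟩
    · exact ⟨i, j, h⟩
  obtain ⟨i, j, h⟩ := hmin
  have hij : i ≠ j := by rintro rfl; simp [minor, mul_comm] at h
  obtain ⟨s, hs2, hs3⟩ : ∃ s : Equiv.Perm (Fin 4), s 2 = i ∧ s 3 = j := by
    clear h; revert i j; decide
  let S : GL (Fin 4) ℝ := Matrix.GeneralLinearGroup.mkOfDetNeZero (s.permMatrix ℝ) (by
    rw [Matrix.det_permutation]; rcases Int.units_eq_one_or s.sign with h | h <;> simp [h])
  refine ⟨S⁻¹, ?_⟩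
  change actFun (S⁻¹)⁻¹ (Quotient.mk frameSetoid ⟨A, hA⟩) ∈ baseChart.source
  rw [inv_inv]
  change 0 < minor (s.permMatrix ℝ * A) 2 3
  simpa [minor, Equiv.Perm.permMatrix, PEquiv.toMatrix_toPEquiv_mul, hs2, hs3] using h

instance : ChartedSpace R4 OGr where
  atlas := range affineChart
  chartAt x := affineChart (exists_mem_affineChart_source x).choose
  mem_chart_source x := (exists_mem_affineChart_source x).choose_spec
  chart_mem_atlas _ := mem_range_self _

theorem affineChart_trans_source (Q R : GL (Fin 4) ℝ) :
    ((affineChart Q).symm ≫ₕ affineChart R).source =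
      {u | 0 < minor ((R⁻¹ * Q).1 * affineFrame u) 2 3} := by
  ext u
  rw [OpenPartialHomeomorph.trans_source]
  change (u ∈ univ ∧ _) ↔ _
  change (u ∈ univ ∧ actFun R⁻¹ (actFun Q (baseChart.symm u)) ∈ baseChart.source) ↔ _
  rw [actFun_actFun]
  exact ⟨fun h => h.2, fun h => ⟨mem_univ _, h⟩⟩

theorem affineChart_trans_apply (Q R : GL (Fin 4) ℝ) (u : R4) :
    ((affineChart Q).symm ≫ₕ affineChart R) u = affineCoord ((R⁻¹ * Q).1 * affineFrame u) := by
  change baseChart (actFun R⁻¹ (actFun Q (baseChart.symm u))) = _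
  rw [actFun_actFun]
  rfl

theorem contDiff_minor (Q : Matrix (Fin 4) (Fin 4) ℝ) (i j : Fin 4) :
    ContDiff ℝ ∞ fun u : R4 => minor (Q * affineFrame u) i j := by
  simp only [minor, Matrix.mul_apply, Fin.sum_univ_four, affineFrame]
  simp
  fun_prop

instance : IsManifold 𝓘(ℝ, R4) ∞ OGr := by
  refine isManifold_of_contDiffOn _ _ _ ?_
  rintro _ _ ⟨Q, rfl⟩ ⟨R, rfl⟩
  simp only [modelWithCornersSelf_coe, modelWithCornersSelf_coe_symm, Function.comp_id,
    Function.id_comp, preimage_id, range_id, inter_univ, affineChart_trans_source]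
  have : ∀ i j, ContDiffOn ℝ ∞ (fun u => minor ((R⁻¹ * Q).1 * affineFrame u) i j /
      minor ((R⁻¹ * Q).1 * affineFrame u) 2 3)
      {u | 0 < minor ((R⁻¹ * Q).1 * affineFrame u) 2 3} := fun i j =>
    (contDiff_minor _ _ _).contDiffOn.div (contDiff_minor _ _ _).contDiffOn
      fun u hu => ne_of_gt hu
  refine contDiffOn_pi.2 fun i => ?_
  refine ContDiffOn.congr (f := fun u => affineCoord ((R⁻¹ * Q).1 * affineFrame u) i) ?_
    fun u _ => by rw [affineChart_trans_apply]
  fin_cases i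
  exacts [this 0 3, this 1 3, this 2 1, this 0 2]

/-- A smooth coordinate chart that is positively oriented with respect to the given atlas. -/
def IsPositiveChart (M : Type*) [TopologicalSpace M] [ChartedSpace R4 M]
    (e : OpenPartialHomeomorph M R4) : Prop :=
  e ∈ IsManifold.maximalAtlas 𝓘(ℝ, R4) ∞ M ∧
    ∀ e' ∈ atlas R4 M, ∀ u ∈ (e.symm ≫ₕ e').source, 0 < (fderiv ℝ (e.symm ≫ₕ e') u).det

set_option linter.unusedSimpArgs false in
theorem det_fderiv_affineCoord_pos (G : Matrix (Fin 4) (Fin 4) ℝ) (hG : G.det ≠ 0) (u : R4)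
    (hu : 0 < minor (G * affineFrame u) 2 3) :
    0 < (fderiv ℝ (fun u => affineCoord (G * affineFrame u)) u).det := by
  set N : R4 → Matrix (Fin 4) (Fin 2) ℝ := fun u => G * affineFrame u with hN
  have hN0 : ∀ i w, N w i 0 = G i 0 * w 0 + G i 1 * w 1 + G i 2 := fun i w => by
    simp [hN, Matrix.mul_apply, Fin.sum_univ_four, affineFrame]
  have hN1 : ∀ i w, N w i 1 = G i 1 * w 2 - G i 0 * w 3 + G i 3 := fun i w => by
    simp [hN, Matrix.mul_apply, Fin.sum_univ_four, affineFrame]; ring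
  let p : Fin 4 → R4 →L[ℝ] ℝ := fun i => ContinuousLinearMap.proj i
  have hp : ∀ i, HasFDerivAt (fun w : R4 => w i) (p i) u := fun i => hasFDerivAt_apply i u
  have d0 : ∀ i, HasFDerivAt (fun w => N w i 0) (G i 0 • p 0 + G i 1 • p 1) u := fun i => by
    simp only [hN0]
    exact (((hp 0).const_mul _).add ((hp 1).const_mul _)).add_const _
  have d1 : ∀ i, HasFDerivAt (fun w => N w i 1) (G i 1 • p 2 - G i 0 • p 3) u := fun i => by
    simp only [hN1]
    exact (((hp 2).const_mul _).sub ((hp 3).const_mul _)).add_const _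
  have dm := fun i j => ((d0 i).mul (d1 j)).sub ((d1 i).mul (d0 j))
  have hd : minor (N u) 2 3 ≠ 0 := hu.ne'
  have dq : ∀ i j, HasFDerivAt (fun w => minor (N w) i j / minor (N w) 2 3) _ u := fun i j =>
    (dm i j).mul ((hasDerivAt_inv hd).comp_hasFDerivAt u (dm 2 3))
  set D := minor (N u) 2 3 with hD
  obtain ⟨y0, hy0⟩ : ∃ z, z = minor (N u) 0 3 / D := ⟨_, rfl⟩
  obtain ⟨y1, hy1⟩ : ∃ z, z = minor (N u) 1 3 / D := ⟨_, rfl⟩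
  obtain ⟨y2, hy2⟩ : ∃ z, z = minor (N u) 2 1 / D := ⟨_, rfl⟩
  obtain ⟨y3, hy3⟩ : ∃ z, z = minor (N u) 0 2 / D := ⟨_, rfl⟩
  obtain ⟨a, ha⟩ : ∃ z, z = G 0 0 - y0 * G 2 0 + y3 * G 3 0 := ⟨_, rfl⟩
  obtain ⟨b, hb⟩ : ∃ z, z = G 0 1 - y0 * G 2 1 + y3 * G 3 1 := ⟨_, rfl⟩
  obtain ⟨c, hc⟩ : ∃ z, z = G 1 0 - y1 * G 2 0 - y2 * G 3 0 := ⟨_, rfl⟩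
  obtain ⟨d, hdd⟩ : ∃ z, z = G 1 1 - y1 * G 2 1 - y2 * G 3 1 := ⟨_, rfl⟩
  obtain ⟨k, hk⟩ : ∃ z, z = N u 3 1 / D := ⟨_, rfl⟩
  obtain ⟨l, hl⟩ : ∃ z, z = - N u 2 1 / D := ⟨_, rfl⟩
  obtain ⟨m, hm⟩ : ∃ z, z = - N u 3 0 / D := ⟨_, rfl⟩
  obtain ⟨n, hn⟩ : ∃ z, z = N u 2 0 / D := ⟨_, rfl⟩
  let J : Matrix (Fin 4) (Fin 4) ℝ := !![a * k, b * k, b * m, -(a * m); c * k, d * k, d * m, -(c * m);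
    c * l, d * l, d * n, -(c * n); -(a * l), -(b * l), -(b * n), a * n]
  have hJ : HasFDerivAt (fun u => affineCoord (N u)) (LinearMap.toContinuousLinearMap J.toLin') u := by
    refine hasFDerivAt_pi'.2 fun i => ?_
    fin_cases i
    · refine (dq 0 3).congr_fderiv ?_
      ext v
      simp [J, dotProduct, Fin.sum_univ_four, p]
      simp only [ha, hb, hc, hdd, hk, hl, hm, hn, hy0, hy1, hy2, hy3]
      field_simp
      simp only [hD, minor]; ring
    · refine (dq 1 3).congr_fderiv ?_
      ext v
      simp [J, dotProduct, Fin.sum_univ_four, p]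
      simp only [ha, hb, hc, hdd, hk, hl, hm, hn, hy0, hy1, hy2, hy3]
      field_simp
      simp only [hD, minor]; ring
    · refine (dq 2 1).congr_fderiv ?_
      ext v
      simp [J, dotProduct, Fin.sum_univ_four, p]
      simp only [ha, hb, hc, hdd, hk, hl, hm, hn, hy0, hy1, hy2, hy3]
      field_simp
      simp only [hD, minor]; ring
    · refine (dq 0 2).congr_fderiv ?_
      ext v
      simp [J, dotProduct, Fin.sum_univ_four, p]
      simp only [ha, hb, hc, hdd, hk, hl, hm, hn, hy0, hy1, hy2, hy3]
      field_simp
      simp only [hD, minor]; ring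
  rw [hJ.fderiv]
  change 0 < LinearMap.det J.toLin'
  have hJd : LinearMap.det J.toLin' = (a * d - b * c) ^ 2 * (k * n - l * m) ^ 2 := by
    rw [LinearMap.det_toLin']
    simp [J, Matrix.det_succ_row_zero, Fin.sum_univ_succ, Fin.succAbove]
    ring
  have h1 : k * n - l * m = 1 / D := by
    rw [hk, hl, hm, hn]; field_simp; rw [hD, minor]; ring
  have h2 : G.det = (a * d - b * c) * D := by
    have e2 : ∀ i, G i 2 = N u i 0 - G i 0 * u 0 - G i 1 * u 1 := fun i => by rw [hN0]; ring
    have e3 : ∀ i, G i 3 = N u i 1 - G i 1 * u 2 + G i 0 * u 3 := fun i => by rw [hN1]; ring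
    have hdet : G.det = (G 0 0 * G 1 1 - G 0 1 * G 1 0) * minor (N u) 2 3
        - (G 0 0 * G 2 1 - G 0 1 * G 2 0) * minor (N u) 1 3
        + (G 0 0 * G 3 1 - G 0 1 * G 3 0) * minor (N u) 1 2
        + (G 1 0 * G 2 1 - G 1 1 * G 2 0) * minor (N u) 0 3
        - (G 1 0 * G 3 1 - G 1 1 * G 3 0) * minor (N u) 0 2
        + (G 2 0 * G 3 1 - G 2 1 * G 3 0) * minor (N u) 0 1 := by
      simp [Matrix.det_succ_row_zero, Fin.sum_univ_succ, Fin.succAbove, minor, e2, e3]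
      ring
    rw [hdet, ha, hb, hc, hdd, hy0, hy1, hy2, hy3, ← hD]
    field_simp
    rw [hD]; simp only [minor]; ring
  rw [hJd, h1]
  have : a * d - b * c ≠ 0 := fun h => hG (by rw [h2, h, zero_mul])
  positivity

/-- The affine charts define an orientation: all their transition maps have positive Jacobian. -/
theorem isPositiveChart_affineChart (Q : GL (Fin 4) ℝ) : IsPositiveChart OGr (affineChart Q) := by
  refine ⟨IsManifold.subset_maximalAtlas (mem_range_self Q), ?_⟩
  rintro _ ⟨R, rfl⟩ u hu
  rw [affineChart_trans_source] at hu
  rw [show (⇑((affineChart Q).symm ≫ₕ affineChart R) : R4 → R4) =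
    fun u => affineCoord ((R⁻¹ * Q).1 * affineFrame u) from
      funext fun u => affineChart_trans_apply Q R u]
  exact det_fderiv_affineCoord_pos _
    ((Matrix.isUnit_iff_isUnit_det _).1 (R⁻¹ * Q).isUnit).ne_zero u hu

/-! Neutral metrics in four dimensions and their curvature. -/

section General

variable {M : Type*} [TopologicalSpace M] [ChartedSpace R4 M]

/-- A field of bilinear forms on the tangent spaces of `M`. For a metric that is defined on a subset
only, the values elsewhere are irrelevant. -/
abbrev FormField (M : Type*) [TopologicalSpace M] [ChartedSpace R4 M] : Type _ :=
  ∀ x : M, LinearMap.BilinForm ℝ (TangentSpace 𝓘(ℝ, R4) x)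

/-- The matrix at `u` of the pull-back of `g` by `Φ : ℝ⁴ → M`. For the inverse `Φ` of a chart, this
is the matrix of `g` in the coordinates of that chart. -/
def pullbackMatrix (g : FormField M) (Φ : R4 → M) (u : R4) : Matrix (Fin 4) (Fin 4) ℝ :=
  Matrix.of fun i j => g (Φ u)
    (mfderiv 𝓘(ℝ, R4) 𝓘(ℝ, R4) Φ u (Pi.single i 1 : R4))
    (mfderiv 𝓘(ℝ, R4) 𝓘(ℝ, R4) Φ u (Pi.single j 1 : R4))

/-- `g` restricts to a smooth metric of signature `(2, 2)` on the open set `Ω`. -/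
structure IsNeutralMetricOn (g : FormField M) (Ω : Set M) : Prop where
  isOpen : IsOpen Ω
  symm : ∀ x ∈ Ω, ∀ v w, g x v w = g x w v
  signature : ∀ x ∈ Ω, ∃ b : Module.Basis (Fin 4) ℝ (TangentSpace 𝓘(ℝ, R4) x),
    ∀ i j, g x (b i) (b j) = if i = j then (if i < 2 then 1 else -1) else 0
  smooth : ∀ e ∈ atlas R4 M, ∀ i j, ContDiffOn ℝ ∞ (fun u => pullbackMatrix g e.symm u i j)
    {u | u ∈ e.target ∧ e.symm u ∈ Ω}

/-- The partial derivative `∂F/∂uᵢ`. -/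
def pderiv4 (i : Fin 4) (F : R4 → ℝ) (u : R4) : ℝ := fderiv ℝ F u (Pi.single i 1)

/-- The Christoffel symbol `Γˡᵢⱼ` of the metric `∑ Gᵢⱼ duᵢ duⱼ`. -/
def christoffel (G : R4 → Matrix (Fin 4) (Fin 4) ℝ) (l i j : Fin 4) (u : R4) : ℝ :=
  (1 / 2) * ∑ m, (G u)⁻¹ l m * (pderiv4 i (fun w => G w m j) u + pderiv4 j (fun w => G w m i) u
    - pderiv4 m (fun w => G w i j) u)

/-- The curvature `Rˡₖᵢⱼ`: the `l`-th component of `R(∂ᵢ, ∂ⱼ) ∂ₖ`. -/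
def riemannUp (G : R4 → Matrix (Fin 4) (Fin 4) ℝ) (l k i j : Fin 4) (u : R4) : ℝ :=
  pderiv4 i (christoffel G l j k) u - pderiv4 j (christoffel G l i k) u
    + ∑ m, (christoffel G l i m u * christoffel G m j k u
      - christoffel G l j m u * christoffel G m i k u)

/-- The curvature `Rₗₖᵢⱼ` with all indices lowered. -/
def riemannDown (G : R4 → Matrix (Fin 4) (Fin 4) ℝ) (l k i j : Fin 4) (u : R4) : ℝ :=
  ∑ m, G u l m * riemannUp G m k i j u

/-- The Ricci curvature. -/
def ricci (G : R4 → Matrix (Fin 4) (Fin 4) ℝ) (k j : Fin 4) (u : R4) : ℝ :=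
  ∑ i, riemannUp G i k i j u

/-- The scalar curvature. -/
def scalarCurv (G : R4 → Matrix (Fin 4) (Fin 4) ℝ) (u : R4) : ℝ :=
  ∑ k, ∑ j, (G u)⁻¹ k j * ricci G k j u

/-- The Weyl curvature `Wₗₖᵢⱼ` in dimension four. -/
def weyl (G : R4 → Matrix (Fin 4) (Fin 4) ℝ) (l k i j : Fin 4) (u : R4) : ℝ :=
  riemannDown G l k i j u
    - (1 / 2) * (G u l i * ricci G k j u - G u l j * ricci G k i u
      - G u k i * ricci G l j u + G u k j * ricci G l i u)
    + (scalarCurv G u / 6) * (G u l i * G u k j - G u l j * G u k i)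

/-- The permutation symbol on four indices: the sign of `(a, b, c, d)`, or `0` if not a permutation. -/
def epsilon4 (a b c d : Fin 4) : ℝ :=
  Matrix.det ((1 : Matrix (Fin 4) (Fin 4) ℝ).submatrix ![a, b, c, d] id)

/-- The Weyl curvature of `G` is self-dual at `u` (its anti-self-dual part vanishes): `⋆W = W`, for
the Hodge star of `G` and of the orientation `du₁ ∧ du₂ ∧ du₃ ∧ du₄` on the first pair of indices. -/
def WeylSelfDualAt (G : R4 → Matrix (Fin 4) (Fin 4) ℝ) (u : R4) : Prop :=
  ∀ l k i j, (1 / 2) * ∑ a, ∑ b, ∑ c, ∑ d, √(G u).det * epsilon4 l k a b *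
    (G u)⁻¹ a c * (G u)⁻¹ b d * weyl G c d i j u = weyl G l k i j u

/-- The conformal structure of `g` is self-dual on `Ω`: around every point, some representative of
it, written in some positively oriented chart, has self-dual Weyl curvature at that point. (The
condition is tensorial and conformally invariant: it does not depend on either choice.) -/
def IsConformallySelfDualOn (g : FormField M) (Ω : Set M) : Prop :=
  ∀ x ∈ Ω, ∃ e, IsPositiveChart M e ∧ x ∈ e.source ∧
    ∃ h : R4 → ℝ, ContDiffAt ℝ ∞ h (e x) ∧ 0 < h (e x) ∧
      WeylSelfDualAt (fun u => h u • pullbackMatrix g e.symm u) (e x)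

/-- Petean's metric `2 (dx₁ dx₃ + dx₂ dx₄) + f(x₁, x₂) (dx₁² + dx₂²)` on `ℝ⁴`. -/
def peteanMetric (f : ℝ × ℝ → ℝ) (x : R4) : Matrix (Fin 4) (Fin 4) ℝ :=
  !![f (x 0, x 1), 0, 1, 0; 0, f (x 0, x 1), 0, 1; 1, 0, 0, 0; 0, 1, 0, 0]

/-- The standard neutral metric `2 (du₁ du₃ + du₂ du₄)`. -/
def stdNeutral : Matrix (Fin 4) (Fin 4) ℝ := !![0, 0, 1, 0; 0, 0, 0, 1; 1, 0, 0, 0; 0, 1, 0, 0]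

/-- With `u₂ = r cos φ` and `u₃ = r sin φ`, the matrix of the symmetric tensor
`r² dφ² = (- sin φ du₂ + cos φ du₃)²`. -/
def angularForm (φ : ℝ) : Matrix (Fin 4) (Fin 4) ℝ :=
  Matrix.vecMulVec ![0, -Real.sin φ, Real.cos φ, 0] ![0, -Real.sin φ, Real.cos φ, 0]

/-- `g` is a singular neutral metric on `M` with singular `β`-surface `C`: it is a neutral metric
outside the closed set `C`, and around every point of `C` there are positively oriented coordinates
`u` in which `C` is `{u₂ = u₃ = 0}` and `h g = 2 (du₁ du₃ + du₂ du₄) + ρ(u₁, u₄, φ) r² dφ² + E`,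
where `(r, φ)` are the polar coordinates of `(u₂, u₃)`, with `E → 0` along `C`. -/
structure IsSingularNeutral (C : Set M) (g : FormField M) : Prop where
  isClosed : IsClosed C
  neutral : IsNeutralMetricOn g Cᶜ
  local_form : ∀ x ∈ C, ∃ e, IsPositiveChart M e ∧ x ∈ e.source ∧
    (∀ u ∈ e.target, e.symm u ∈ C ↔ u 1 = 0 ∧ u 2 = 0) ∧
    ∃ (h : R4 → ℝ) (ρ : ℝ × ℝ × ℝ → ℝ) (E : R4 → Matrix (Fin 4) (Fin 4) ℝ),
      ContDiffOn ℝ ∞ h {u | u ∈ e.target ∧ e.symm u ∉ C} ∧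
      (∀ u ∈ e.target, e.symm u ∉ C → 0 < h u) ∧
      ContDiffOn ℝ ∞ ρ {p | ![p.1, 0, 0, p.2.1] ∈ e.target} ∧
      (∀ a d r φ : ℝ, 0 < r → ![a, r * Real.cos φ, r * Real.sin φ, d] ∈ e.target →
        h ![a, r * Real.cos φ, r * Real.sin φ, d] •
            pullbackMatrix g e.symm ![a, r * Real.cos φ, r * Real.sin φ, d] =
          stdNeutral + ρ (a, d, φ) • angularForm φ + E ![a, r * Real.cos φ, r * Real.sin φ, d]) ∧
      ∀ p ∈ e.target, e.symm p ∈ C →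
        Tendsto E (𝓝[{u | u ∈ e.target ∧ e.symm u ∉ C}] p) (𝓝 0)

end General

/-! The pieces of the Grassmannian and the induced conformal structure. -/

/-- The frame of `(t, v) ∈ T S²`, that is `|t| = 1`, `⟨t, v⟩ = 0`, with last row `(0, s)`. -/
def tangentFrame (t v : Fin 3 → ℝ) (s : ℝ) : Matrix (Fin 4) (Fin 2) ℝ :=
  !![t 0, -v 0; t 1, -v 1; t 2, -v 2; 0, s]

/-- The tangent bundle `T S²` as a subset of the Grassmannian. -/
def TS2 : Set OGr := {x | ∃ t v : Fin 3 → ℝ, t ⬝ᵥ t = 1 ∧ t ⬝ᵥ v = 0 ∧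
  ∃ h : (tangentFrame t v 1).rank = 2, x = OGr.mk (tangentFrame t v 1) h}

/-- The sphere `S²_∞` of the oriented planes contained in `ℝ³ × {0}`. -/
def S2inf : Set OGr := {x | ∃ A, ∃ h : A.rank = 2, A 3 0 = 0 ∧ A 3 1 = 0 ∧ x = OGr.mk A h}

/-- The frame of the point of `T D_±` with coordinates `x`, where `ε = ±1`. -/
def tdFrame (ε : ℤˣ) (x : R4) : Matrix (Fin 4) (Fin 2) ℝ :=
  !![(ε : ℤ) * x 0, -x 3; (ε : ℤ) * x 1, x 2; (ε : ℤ), 0; 0, 1]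

theorem rank_tdFrame (ε : ℤˣ) (x : R4) : (tdFrame ε x).rank = 2 :=
  rank_eq_two_of_minor (i := 2) (j := 3) (by simp [minor, tdFrame])

/-- The coordinates `(x₁, x₂, x₃, x₄)` on `T D_±`, the restriction of `T S²` to the open hemisphere
`D_± = {± t₃ > 0}`. -/
def tdPoint (ε : ℤˣ) (x : R4) : OGr := OGr.mk (tdFrame ε x) (rank_tdFrame ε x)

/-- `f` is invariant under `SO(2)`. -/
def IsAxisymmetric (f : ℝ × ℝ → ℝ) : Prop := ∀ θ a b : ℝ,
  f (Real.cos θ * a - Real.sin θ * b, Real.sin θ * a + Real.cos θ * b) = f (a, b)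

/-- `g` represents the conformal structure on `T S²` that is induced by the Petean metrics of `fp`
on `T D_+` and of `fm` on `T D_-`: it is a neutral metric on `T S²`, and on `T D_±` it is conformal
to these metrics. -/
structure IsInduced (fp fm : ℝ × ℝ → ℝ) (g : FormField OGr) : Prop where
  neutral : IsNeutralMetricOn g TS2
  plus : ∀ x, ∃ c : ℝ, 0 < c ∧ pullbackMatrix g (tdPoint 1) x = c • peteanMetric fp x
  minus : ∀ x, ∃ c : ℝ, 0 < c ∧ pullbackMatrix g (tdPoint (-1)) x = c • peteanMetric fm x

end

/-! The minors of a frame are the Plücker coordinates `p` of its plane. They are defined up to a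
positive factor, and the oriented Grassmannian is the set of rays in the null cone of `plForm`. The
tangent space of the cone at `p` is orthogonal to `p`, so `plForm` induces a flat neutral conformal
structure on the whole Grassmannian. In every affine chart it is the constant matrix `Q.det *
stdNeutral` (`plForm_dMinor`).

The vector T = (`p 0 3`, `p 1 3`, `p 2 3`) spans the intersection of the plane with ℝ³ × {0} and
vanishes exactly on `S2inf`. On both hemispheres x₁ = T₀/T₂ and x₂ = T₁/T₂, so the Petean term is a
multiple of d(T₀/T₂)² + d(T₁/T₂)². Written homogeneously in `p` it can be added to `plForm`
(`inducedForm`), and the normalization |T| = 1 selects a metric. Compact support makes its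
coefficient vanish near every T ≠ 0 with T₂ = 0. The two metrics thus glue across that wall through
a conformally flat region.

Conversely, an induced metric is a positive multiple of this one off the wall. The wall has dense
complement in `TS2`, so continuity and nondegeneracy extend the statement across it
(`IsInduced.pullbackMatrix_eq`). Everything then reduces to the explicit `chartMatrix`.

Self-duality: the curvature of a Petean metric is a multiple of (dx₁ ∧ dx₂)⊗(dx₁ ∧ dx₂), it is
Ricci-flat, and dx₁ ∧ dx₂ is self-dual (`weylSelfDualAt_peteanMetric`).

Local form: in a chart adapted to a plane in `S2inf`, T is homogeneous of degree one in (u₂, u₃) and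
the coefficient has degree -2 in T. The leading part of the Petean term is then ρ r² dφ², and the
rest is a bounded factor times one that vanishes on the surface (`IsAdapted.chartMatrix_eq`,
`IsAdapted.tendsto_errorMatrix`). -/

noncomputable section

/-! ### Plücker coordinates and the induced metric in affine charts -/

/-- The polarization of the (negated) Plücker quadric on `Λ² ℝ⁴`. -/
def plForm (a b : Fin 4 → Fin 4 → ℝ) : ℝ :=
  a 0 2 * b 1 3 + a 1 3 * b 0 2 - a 0 1 * b 2 3 - a 2 3 * b 0 1 - a 0 3 * b 1 2 - a 1 2 * b 0 3

/-- The derivative of the minor `(k, l)` of `Q * affineFrame u` in the direction `i`. -/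
def dMinor (Q : Matrix (Fin 4) (Fin 4) ℝ) (u : R4) (i k l : Fin 4) : ℝ :=
  ![Q k 0, Q k 1, 0, 0] i * (Q * affineFrame u) l 1 + (Q * affineFrame u) k 0 * ![0, 0, Q l 1, -Q l 0] i
    - ![0, 0, Q k 1, -Q k 0] i * (Q * affineFrame u) l 0 - (Q * affineFrame u) k 1 * ![Q l 0, Q l 1, 0, 0] i

theorem mul_affineFrame_zero (Q : Matrix (Fin 4) (Fin 4) ℝ) (u : R4) (i : Fin 4) :
    (Q * affineFrame u) i 0 = Q i 0 * u 0 + Q i 1 * u 1 + Q i 2 := by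
  simp [Matrix.mul_apply, Fin.sum_univ_four, affineFrame]

theorem mul_affineFrame_one (Q : Matrix (Fin 4) (Fin 4) ℝ) (u : R4) (i : Fin 4) :
    (Q * affineFrame u) i 1 = Q i 1 * u 2 - Q i 0 * u 3 + Q i 3 := by
  simp [Matrix.mul_apply, Fin.sum_univ_four, affineFrame]; ring

theorem pderiv4_minor (Q : Matrix (Fin 4) (Fin 4) ℝ) (u : R4) (i k l : Fin 4) :
    pderiv4 i (fun u => minor (Q * affineFrame u) k l) u = dMinor Q u i k l := by
  have hp : ∀ i, HasFDerivAt (fun w : R4 => w i) (ContinuousLinearMap.proj i : R4 →L[ℝ] ℝ) u :=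
    fun i => hasFDerivAt_apply i u
  have d0 : ∀ i, HasFDerivAt (fun w => (Q * affineFrame w) i 0) _ u := fun i => by
    simp only [mul_affineFrame_zero]
    exact (((hp 0).const_mul _).add ((hp 1).const_mul _)).add_const _
  have d1 : ∀ i, HasFDerivAt (fun w => (Q * affineFrame w) i 1) _ u := fun i => by
    simp only [mul_affineFrame_one]
    exact (((hp 2).const_mul _).sub ((hp 3).const_mul _)).add_const _
  have := ((d0 k).mul (d1 l)).sub ((d1 k).mul (d0 l))
  rw [pderiv4, show (fun u => minor (Q * affineFrame u) k l) = fun u => (Q * affineFrame u) k 0 *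
    (Q * affineFrame u) l 1 - (Q * affineFrame u) k 1 * (Q * affineFrame u) l 0 from rfl]
  erw [this.fderiv]
  fin_cases i <;> simp [dMinor] <;> ring

/-- The columns of `Q * affineFrame u` differ from the last two columns of `Q` by combinations of
the first two, so this is a Laplace expansion along the first two columns. -/
theorem det_eq_affineFrame (Q : Matrix (Fin 4) (Fin 4) ℝ) (u : R4) : Q.det =
    (Q 0 0 * Q 1 1 - Q 0 1 * Q 1 0) * minor (Q * affineFrame u) 2 3
      - (Q 0 0 * Q 2 1 - Q 0 1 * Q 2 0) * minor (Q * affineFrame u) 1 3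
      + (Q 0 0 * Q 3 1 - Q 0 1 * Q 3 0) * minor (Q * affineFrame u) 1 2
      + (Q 1 0 * Q 2 1 - Q 1 1 * Q 2 0) * minor (Q * affineFrame u) 0 3
      - (Q 1 0 * Q 3 1 - Q 1 1 * Q 3 0) * minor (Q * affineFrame u) 0 2
      + (Q 2 0 * Q 3 1 - Q 2 1 * Q 3 0) * minor (Q * affineFrame u) 0 1 := by
  simp only [minor, mul_affineFrame_zero, mul_affineFrame_one]
  simp [Matrix.det_succ_row_zero, Fin.sum_univ_succ, Fin.succAbove]
  ring

-- The action of `Q` on bivectors multiplies the wedge pairing by `Q.det`, so the flat conformal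
-- structure looks the same in all affine charts.
set_option maxHeartbeats 1000000 in
theorem plForm_dMinor (Q : Matrix (Fin 4) (Fin 4) ℝ) (u : R4) (i j : Fin 4) :
    plForm (dMinor Q u i) (dMinor Q u j) = Q.det * stdNeutral i j := by
  rw [det_eq_affineFrame Q u]
  simp only [plForm, dMinor, minor]
  generalize Q * affineFrame u = N
  fin_cases i <;> fin_cases j <;> simp [stdNeutral] <;> ring

theorem plForm_minor_self (A : Matrix (Fin 4) (Fin 2) ℝ) : plForm (minor A) (minor A) = 0 := by
  simp only [plForm, minor]; ring

/-- This is the derivative of the Plücker relation `plForm_minor_self`. -/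
theorem plForm_dMinor_minor (Q : Matrix (Fin 4) (Fin 4) ℝ) (u : R4) (i : Fin 4) :
    plForm (dMinor Q u i) (minor (Q * affineFrame u)) = 0 := by
  simp only [plForm, dMinor, minor]
  generalize Q * affineFrame u = N
  fin_cases i <;> simp <;> ring

/-- The direction `t` of a frame, up to a positive factor. -/
def direction (p : Fin 4 → Fin 4 → ℝ) : Fin 3 → ℝ := ![p 0 3, p 1 3, p 2 3]

/-- The coefficient of the Petean terms, homogeneous of degree `-2`. -/
def coneCoeff (fp fm : ℝ × ℝ → ℝ) (T : Fin 3 → ℝ) : ℝ :=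
  if 0 < T 2 then fp (T 0 / T 2, T 1 / T 2) / T 2 ^ 2
  else if T 2 < 0 then fm (T 0 / T 2, T 1 / T 2) / T 2 ^ 2 else 0

theorem coneCoeff_smul (fp fm : ℝ × ℝ → ℝ) {r : ℝ} (hr : 0 < r) (T : Fin 3 → ℝ) :
    coneCoeff fp fm (r • T) = coneCoeff fp fm T / r ^ 2 := by
  simp only [coneCoeff, Pi.smul_apply, smul_eq_mul, mul_pos_iff_of_pos_left hr, show r * T 2 < 0 ↔ T 2 < 0 from smul_neg_iff_of_pos_left hr,
    mul_div_mul_left _ _ hr.ne', mul_pow]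
  split_ifs <;> first | simp | field_simp

/-- The numerator of the differential of `T k / T 2`. -/
def quotDiff (p a : Fin 4 → Fin 4 → ℝ) (k : Fin 4) : ℝ := p 2 3 * a k 3 - p k 3 * a 2 3

/-- The induced metric at a point with Plücker coordinates `p`, on vectors that change the Plücker
coordinates by `a` and `b`. -/
def inducedForm (fp fm : ℝ × ℝ → ℝ) (p a b : Fin 4 → Fin 4 → ℝ) : ℝ :=
  plForm a b + coneCoeff fp fm (direction p) *
    (quotDiff p a 0 * quotDiff p b 0 + quotDiff p a 1 * quotDiff p b 1)

/-- Controls a change of normalization of the Plücker coordinates. Multiples of `p` drop out of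
`plForm` by orthogonality and out of `quotDiff` by antisymmetry; the degrees -2 of the coefficient
and 4 of the squares combine to 2. -/
theorem inducedForm_smul (fp fm : ℝ × ℝ → ℝ) {p a b : Fin 4 → Fin 4 → ℝ} {r : ℝ} (hr : 0 < r) (μ ν : ℝ)
    (hp : plForm p p = 0) (ha : plForm a p = 0) (hb : plForm b p = 0) :
    inducedForm fp fm (r • p) (r • a + μ • p) (r • b + ν • p) = r ^ 2 * inducedForm fp fm p a b := by
  have hd : direction (r • p) = r • direction p := by
    ext k; fin_cases k <;> simp [direction]
  have h1 : plForm (r • a + μ • p) (r • b + ν • p) = r ^ 2 * plForm a b + r * ν * plForm a p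
      + r * μ * plForm b p + μ * ν * plForm p p := by
    simp [plForm]; ring
  rw [inducedForm, h1, hp, ha, hb, hd, coneCoeff_smul _ _ hr, inducedForm]
  simp only [quotDiff, Pi.add_apply, Pi.smul_apply, smul_eq_mul]
  field_simp
  ring

/-- The squared length of the direction of a frame. -/
def dirNormSq (A : Matrix (Fin 4) (Fin 2) ℝ) : ℝ := minor A 0 3 ^ 2 + minor A 1 3 ^ 2 + minor A 2 3 ^ 2

/-- The Plücker coordinates, normalized such that the direction has length one. -/
def normPlucker (x : OGr) (i j : Fin 4) : ℝ :=
  Quotient.lift (fun A : Frame => minor A.1 i j / √(dirNormSq A.1)) (by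
    rintro A B ⟨P, hP, h⟩
    have : dirNormSq B.1 = P.det ^ 2 * dirNormSq A.1 := by simp only [dirNormSq, h, minor_mul]; ring
    simp only [this, Real.sqrt_mul (sq_nonneg P.det), Real.sqrt_sq hP.le]
    rw [h, minor_mul, mul_comm _ P.det, mul_div_mul_left _ _ hP.ne']) x

/-- The differential of `normPlucker`. -/
def dNormPlucker (x : OGr) (i j : Fin 4) : TangentSpace 𝓘(ℝ, R4) x →L[ℝ] ℝ :=
  mfderiv 𝓘(ℝ, R4) 𝓘(ℝ, ℝ) (fun y => normPlucker y i j) x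

/-- A metric on `T S²` that induces the two Petean metrics up to positive factors. -/
def inducedMetric (fp fm : ℝ × ℝ → ℝ) : FormField OGr := fun x =>
  LinearMap.mk₂ ℝ (fun v w => inducedForm fp fm (normPlucker x) (fun i j => dNormPlucker x i j v)
    (fun i j => dNormPlucker x i j w))
    (fun v v' w => by simp only [map_add, inducedForm, plForm, quotDiff]; ring)
    (fun c v w => by simp only [map_smul, smul_eq_mul, inducedForm, plForm, quotDiff]; ring)
    (fun v w w' => by simp only [map_add, inducedForm, plForm, quotDiff]; ring)
    (fun c v w => by simp only [map_smul, smul_eq_mul, inducedForm, plForm, quotDiff]; ring)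

theorem affineChart_symm_apply (Q : GL (Fin 4) ℝ) (u : R4) (h : (Q.1 * affineFrame u).rank = 2) :
    (affineChart Q).symm u = OGr.mk (Q.1 * affineFrame u) h := rfl

theorem normPlucker_affineChart_symm (Q : GL (Fin 4) ℝ) (u : R4) (i j : Fin 4) :
    normPlucker ((affineChart Q).symm u) i j =
      minor (Q.1 * affineFrame u) i j / √(dirNormSq (Q.1 * affineFrame u)) := rfl

theorem affineChart_target (Q : GL (Fin 4) ℝ) : (affineChart Q).target = univ := by
  simp [affineChart, baseChart]

theorem mem_affineChart_source (Q : GL (Fin 4) ℝ) (A : Matrix (Fin 4) (Fin 2) ℝ) (h : A.rank = 2) :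
    OGr.mk A h ∈ (affineChart Q).source ↔ 0 < minor ((Q⁻¹).1 * A) 2 3 := Iff.rfl

theorem contDiff_dirNormSq (Q : Matrix (Fin 4) (Fin 4) ℝ) :
    ContDiff ℝ ∞ fun u : R4 => dirNormSq (Q * affineFrame u) :=
  (((contDiff_minor Q 0 3).pow 2).add ((contDiff_minor Q 1 3).pow 2)).add ((contDiff_minor Q 2 3).pow 2)

theorem contDiffAt_normPlucker (Q : GL (Fin 4) ℝ) {u : R4} (i j : Fin 4)
    (hu : 0 < dirNormSq (Q.1 * affineFrame u)) :
    ContDiffAt ℝ ∞ (fun u => normPlucker ((affineChart Q).symm u) i j) u := by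
  simp only [normPlucker_affineChart_symm]
  exact (contDiff_minor _ _ _).contDiffAt.div ((contDiff_dirNormSq _).contDiffAt.sqrt hu.ne')
    (Real.sqrt_pos.2 hu).ne'

theorem mdifferentiableAt_affineChart_symm (Q : GL (Fin 4) ℝ) (u : R4) :
    MDifferentiableAt 𝓘(ℝ, R4) 𝓘(ℝ, R4) (affineChart Q).symm u :=
  mdifferentiableAt_atlas_symm (mem_range_self Q) (by simp [affineChart_target])

theorem mdifferentiableAt_normPlucker (Q : GL (Fin 4) ℝ) {u : R4} (i j : Fin 4)
    (hu : 0 < dirNormSq (Q.1 * affineFrame u)) :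
    MDifferentiableAt 𝓘(ℝ, R4) 𝓘(ℝ, ℝ) (fun y => normPlucker y i j) ((affineChart Q).symm u) := by
  set e := affineChart Q
  have hu' : u ∈ e.target := by simp [e, affineChart_target]
  have h1 : MDifferentiableAt 𝓘(ℝ, R4) 𝓘(ℝ, R4) e (e.symm u) :=
    mdifferentiableAt_atlas (mem_range_self Q) (e.map_target hu')
  have h2 : MDifferentiableAt 𝓘(ℝ, R4) 𝓘(ℝ, ℝ) (fun u => normPlucker (e.symm u) i j) (e (e.symm u)) := by
    rw [e.right_inv hu']
    exact ((contDiffAt_normPlucker Q i j hu).differentiableAt (by simp)).mdifferentiableAt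
  refine (h2.comp _ h1).congr_of_eventuallyEq ?_
  filter_upwards [e.open_source.mem_nhds (e.map_target hu')] with y hy
  simp [e.left_inv hy]

theorem dNormPlucker_affineChart (Q : GL (Fin 4) ℝ) {u : R4} (i j : Fin 4)
    (hu : 0 < dirNormSq (Q.1 * affineFrame u)) (v : R4) :
    dNormPlucker ((affineChart Q).symm u) i j (mfderiv 𝓘(ℝ, R4) 𝓘(ℝ, R4) (affineChart Q).symm u v) =
      fderiv ℝ (fun u => normPlucker ((affineChart Q).symm u) i j) u v := by
  have := mfderiv_comp u (mdifferentiableAt_normPlucker Q i j hu) (mdifferentiableAt_affineChart_symm Q u)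
  rw [← mfderiv_eq_fderiv]
  exact (congrArg (fun L => L v) this).symm

/-- The matrix of the induced metric in an affine chart, up to the factor `dirNormSq`. -/
def chartMatrix (fp fm : ℝ × ℝ → ℝ) (Q : Matrix (Fin 4) (Fin 4) ℝ) (u : R4) : Matrix (Fin 4) (Fin 4) ℝ :=
  Matrix.of fun i j => Q.det * stdNeutral i j +
    coneCoeff fp fm (direction (minor (Q * affineFrame u))) *
      (quotDiff (minor (Q * affineFrame u)) (dMinor Q u i) 0 *
        quotDiff (minor (Q * affineFrame u)) (dMinor Q u j) 0 +
      quotDiff (minor (Q * affineFrame u)) (dMinor Q u i) 1 *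
        quotDiff (minor (Q * affineFrame u)) (dMinor Q u j) 1)

/-- The normalized coordinates are `r` times the minors, with `r` = 1/|T|. The derivative of `r`
only adds multiples of the position vector, which `inducedForm_smul` discards. -/
theorem pullbackMatrix_inducedMetric (fp fm : ℝ × ℝ → ℝ) (Q : GL (Fin 4) ℝ) {u : R4}
    (hu : 0 < dirNormSq (Q.1 * affineFrame u)) :
    pullbackMatrix (inducedMetric fp fm) (affineChart Q).symm u =
      (dirNormSq (Q.1 * affineFrame u))⁻¹ • chartMatrix fp fm Q.1 u := by
  set r : R4 → ℝ := fun u => (√(dirNormSq (Q.1 * affineFrame u)))⁻¹ with hr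
  have hr0 : 0 < r u := by simp only [hr]; positivity
  have hrd : DifferentiableAt ℝ r u := by
    refine ContDiffAt.differentiableAt (n := ∞) ?_ (by simp)
    exact ((contDiff_dirNormSq _).contDiffAt.sqrt hu.ne').inv (Real.sqrt_pos.2 hu).ne'
  have hP : normPlucker ((affineChart Q).symm u) = r u • minor (Q.1 * affineFrame u) := by
    ext k l
    rw [normPlucker_affineChart_symm]
    simp only [Pi.smul_apply, smul_eq_mul, hr]; ring
  have hD : ∀ i, (fun k l => dNormPlucker ((affineChart Q).symm u) k l
      (mfderiv 𝓘(ℝ, R4) 𝓘(ℝ, R4) (affineChart Q).symm u (Pi.single i 1 : R4))) =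
      r u • dMinor Q.1 u i + pderiv4 i r u • minor (Q.1 * affineFrame u) := by
    intro i
    ext k l
    rw [dNormPlucker_affineChart _ _ _ hu]
    have hm : DifferentiableAt ℝ (fun u => minor (Q.1 * affineFrame u) k l) u :=
      (contDiff_minor _ _ _).contDiffAt.differentiableAt (by simp)
    have : (fun u => normPlucker ((affineChart Q).symm u) k l) =
        fun u => r u * minor (Q.1 * affineFrame u) k l := by
      ext w; rw [normPlucker_affineChart_symm]; simp only [hr]; ring
    rw [this, fderiv_fun_mul hrd hm]
    have h := pderiv4_minor Q.1 u i k l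
    rw [pderiv4] at h
    simp [h, pderiv4]
    ring
  ext i j
  change inducedForm fp fm _ _ _ = _
  rw [hP, hD, hD, inducedForm_smul fp fm hr0 _ _ (plForm_minor_self _) (plForm_dMinor_minor _ _ _)
    (plForm_dMinor_minor _ _ _), inducedForm, plForm_dMinor]
  simp only [hr, inv_pow, Real.sq_sqrt hu.le]
  rfl

/-! ### The singular sphere and its complement -/

theorem mk_mem_S2inf {A : Matrix (Fin 4) (Fin 2) ℝ} (h : A.rank = 2) :
    OGr.mk A h ∈ S2inf ↔ A 3 0 = 0 ∧ A 3 1 = 0 := by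
  constructor
  · rintro ⟨B, hB, h0, h1, e⟩
    obtain ⟨P, -, hP⟩ := Quotient.exact e.symm
    change A = B * P at hP
    simp [hP, Matrix.mul_apply, Fin.sum_univ_two, h0, h1]
  · exact fun hA => ⟨A, h, hA.1, hA.2, rfl⟩

/-- The last row times any minor is a combination of minors containing that row. If the latter all
vanish, a nonzero minor forces the last row to be zero. -/
theorem mk_mem_S2inf_compl {A : Matrix (Fin 4) (Fin 2) ℝ} (h : A.rank = 2) :
    OGr.mk A h ∈ S2infᶜ ↔ 0 < dirNormSq A := by
  rw [mem_compl_iff, mk_mem_S2inf]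
  constructor
  · intro hA
    by_contra hn
    have h0 : dirNormSq A = 0 := le_antisymm (not_lt.1 hn) (by rw [dirNormSq]; positivity)
    rw [dirNormSq] at h0
    have hz : ∀ k, minor A k 3 = 0 := by
      intro k
      fin_cases k
      · change minor A 0 3 = 0; nlinarith [sq_nonneg (minor A 0 3), sq_nonneg (minor A 1 3), sq_nonneg (minor A 2 3)]
      · change minor A 1 3 = 0; nlinarith [sq_nonneg (minor A 0 3), sq_nonneg (minor A 1 3), sq_nonneg (minor A 2 3)]
      · change minor A 2 3 = 0; nlinarith [sq_nonneg (minor A 0 3), sq_nonneg (minor A 1 3), sq_nonneg (minor A 2 3)]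
      · simp [minor, mul_comm]
    obtain ⟨i, j, hij⟩ := exists_minor_ne_zero h
    simp only [minor] at hz hij
    have e0 : A 3 0 * (A i 0 * A j 1 - A i 1 * A j 0) = 0 := by
      linear_combination A j 0 * hz i - A i 0 * hz j
    have e1 : A 3 1 * (A i 0 * A j 1 - A i 1 * A j 0) = 0 := by
      linear_combination A j 1 * hz i - A i 1 * hz j
    exact hA ⟨(mul_eq_zero.1 e0).resolve_right hij, (mul_eq_zero.1 e1).resolve_right hij⟩
  · rintro hA ⟨h0, h1⟩
    simp [dirNormSq, minor, h0, h1] at hA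

/-- A plane not contained in ℝ³ × {0} meets it in a line, oriented by the normalized direction `t`.
A vector of the plane with last entry 1, made orthogonal to `t` by adding a multiple of `t`,
supplies `-v`. -/
theorem TS2_eq_compl : TS2 = S2infᶜ := by
  ext x
  constructor
  · rintro ⟨t, v, -, -, h, rfl⟩
    rw [mem_compl_iff, mk_mem_S2inf]
    simp [tangentFrame]
  · obtain ⟨A, hA⟩ := x
    change OGr.mk A hA ∈ S2infᶜ → OGr.mk A hA ∈ TS2
    intro hx
    have hN := (mk_mem_S2inf_compl hA).1 hx
    rw [mem_compl_iff, mk_mem_S2inf] at hx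
    have hs : 0 < A 3 0 ^ 2 + A 3 1 ^ 2 := by
      rcases eq_or_ne (A 3 0) 0 with h0 | h0
      · have : A 3 1 ≠ 0 := fun h1 => hx ⟨h0, h1⟩
        positivity
      · positivity
    obtain ⟨s, hs'⟩ : ∃ s, s = A 3 0 ^ 2 + A 3 1 ^ 2 := ⟨_, rfl⟩
    rw [← hs'] at hs
    obtain ⟨l, hl⟩ : ∃ l, l = (√(dirNormSq A))⁻¹ := ⟨_, rfl⟩
    have hl0 : 0 < l := by rw [hl]; positivity
    have hl2 : l ^ 2 * dirNormSq A = 1 := by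
      rw [hl, inv_pow, Real.sq_sqrt hN.le, inv_mul_cancel₀ hN.ne']
    let t : Fin 3 → ℝ := fun k => l * minor A k.castSucc 3
    -- The frame applied to its own last row divided by `s` is a vector of the plane with last entry
    -- 1; `w` is its part in ℝ³.
    let w : Fin 3 → ℝ := fun k => (A k.castSucc 0 * A 3 0 + A k.castSucc 1 * A 3 1) / s
    have ht : t ⬝ᵥ t = 1 := by
      rw [← hl2]; simp [t, dotProduct, Fin.sum_univ_three, dirNormSq]; ring
    let c := t ⬝ᵥ w
    let v : Fin 3 → ℝ := c • t - w
    have hv : t ⬝ᵥ v = 0 := by simp [v, dotProduct_sub, ht, c]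
    let P : Matrix (Fin 2) (Fin 2) ℝ :=
      !![l * A 3 1, A 3 0 / s - c * (l * A 3 1); -(l * A 3 0), A 3 1 / s + c * (l * A 3 0)]
    have hP : P.det = l := by
      simp only [P, Matrix.det_fin_two_of]; field_simp; rw [hs']; ring
    have hAP : tangentFrame t v 1 = A * P := by
      ext i j
      rw [Matrix.mul_apply, Fin.sum_univ_two]
      fin_cases j
      · fin_cases i <;> simp [tangentFrame, t, P, minor] <;> ring
      · fin_cases i
        · simp [tangentFrame, v, t, w, P, minor]; ring
        · simp [tangentFrame, v, t, w, P, minor]; ring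
        · simp [tangentFrame, v, t, w, P, minor]; ring
        · simp [tangentFrame, P]; field_simp; rw [hs']; ring
    refine ⟨t, v, ht, hv, ?_, Quotient.sound ⟨P, by rw [hP]; exact hl0, hAP⟩⟩
    rw [hAP, Matrix.rank_mul_eq_left_of_isUnit_det _ _ (by rw [hP]; exact hl0.ne'.isUnit), hA]

theorem affineChart_symm_mem_S2inf_compl (Q : GL (Fin 4) ℝ) (u : R4) :
    (affineChart Q).symm u ∈ S2infᶜ ↔ 0 < dirNormSq (Q.1 * affineFrame u) :=
  mk_mem_S2inf_compl _

theorem direction_ne_zero {A : Matrix (Fin 4) (Fin 2) ℝ} (h : 0 < dirNormSq A) :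
    direction (minor A) ≠ 0 := by
  intro h0
  have e : ∀ k, direction (minor A) k = 0 := fun k => by rw [h0]; rfl
  have e0 : minor A 0 3 = 0 := e 0
  have e1 : minor A 1 3 = 0 := e 1
  have e2 : minor A 2 3 = 0 := e 2
  simp [dirNormSq, e0, e1, e2] at h

theorem isClosed_S2inf : IsClosed S2inf := by
  have hq : IsQuotientMap (Quotient.mk frameSetoid) := isQuotientMap_quot_mk
  rw [← isOpen_compl_iff]
  refine hq.isOpen_preimage.1 ?_
  have : Quotient.mk frameSetoid ⁻¹' S2infᶜ = {A : Frame | 0 < dirNormSq A.1} := by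
    ext ⟨A, hA⟩; exact mk_mem_S2inf_compl hA
  exact (congrArg IsOpen this).mpr (isOpen_lt continuous_const ((((continuous_minor 0 3).pow 2).add
    ((continuous_minor 1 3).pow 2)).add ((continuous_minor 2 3).pow 2)))

/-! ### Smoothness and decay of the Petean coefficient -/

theorem exists_support_radius {f : ℝ × ℝ → ℝ} (hf : HasCompactSupport f) :
    ∃ R, 0 < R ∧ ∀ p, f p ≠ 0 → p.1 ^ 2 + p.2 ^ 2 ≤ R := by
  obtain ⟨R, hR⟩ := (hf.isCompact.image (f := fun p : ℝ × ℝ => p.1 ^ 2 + p.2 ^ 2) (by fun_prop)).bddAbove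
  refine ⟨max R 1, by positivity, fun p hp => (hR ⟨p, subset_tsupport f hp, rfl⟩).trans (le_max_left _ _)⟩

section ConeCoeff

variable {fp fm : ℝ × ℝ → ℝ}

/-- Compact support in T₀/T₂ and T₁/T₂ confines the coefficient to a double cone around the third
axis, which meets the plane T₂ = 0 only at the origin. -/
theorem exists_coneCoeff_radius (hp_supp : HasCompactSupport fp) (hm_supp : HasCompactSupport fm) :
    ∃ R, 0 < R ∧ ∀ T, coneCoeff fp fm T ≠ 0 → T 0 ^ 2 + T 1 ^ 2 ≤ R * T 2 ^ 2 := by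
  obtain ⟨R, hR, h1⟩ := exists_support_radius hp_supp
  obtain ⟨S, hS, h2⟩ := exists_support_radius hm_supp
  refine ⟨max R S, by positivity, fun T hT => ?_⟩
  have key : ∀ {f : ℝ × ℝ → ℝ} {r : ℝ}, (∀ p, f p ≠ 0 → p.1 ^ 2 + p.2 ^ 2 ≤ r) → T 2 ≠ 0 →
      f (T 0 / T 2, T 1 / T 2) / T 2 ^ 2 ≠ 0 → T 0 ^ 2 + T 1 ^ 2 ≤ r * T 2 ^ 2 := by
    intro f r h hne h0
    have := h _ (div_ne_zero_iff.1 h0).1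
    simp only [div_pow, ← add_div] at this
    rwa [div_le_iff₀ (by positivity)] at this
  rw [coneCoeff] at hT
  split_ifs at hT with h h'
  · exact (key h1 h.ne' hT).trans (by gcongr; exact le_max_left _ _)
  · exact (key h2 h'.ne hT).trans (by gcongr; exact le_max_right _ _)
  · exact absurd rfl hT

theorem coneCoeff_eventually_eq_zero (hp_supp : HasCompactSupport fp) (hm_supp : HasCompactSupport fm)
    {T : Fin 3 → ℝ} (hT : T ≠ 0) (h2 : T 2 = 0) : ∀ᶠ S in 𝓝 T, coneCoeff fp fm S = 0 := by
  obtain ⟨R, hR, h⟩ := exists_coneCoeff_radius hp_supp hm_supp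
  have hT' : R * T 2 ^ 2 < T 0 ^ 2 + T 1 ^ 2 := by
    by_contra hc
    refine hT (funext fun k => ?_)
    rw [h2] at hc
    fin_cases k
    · change T 0 = 0; nlinarith [sq_nonneg (T 0), sq_nonneg (T 1)]
    · change T 1 = 0; nlinarith [sq_nonneg (T 0), sq_nonneg (T 1)]
    · exact h2
  have ho : IsOpen {S : Fin 3 → ℝ | R * S 2 ^ 2 < S 0 ^ 2 + S 1 ^ 2} := isOpen_lt (by fun_prop) (by fun_prop)
  filter_upwards [ho.mem_nhds hT'] with S hS
  by_contra hc
  exact absurd (h S hc) (not_le.2 hS)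

theorem contDiffAt_coneCoeff (hp_smooth : ContDiff ℝ ∞ fp) (hm_smooth : ContDiff ℝ ∞ fm)
    (hp_supp : HasCompactSupport fp) (hm_supp : HasCompactSupport fm) {T : Fin 3 → ℝ} (hT : T ≠ 0) :
    ContDiffAt ℝ ∞ (coneCoeff fp fm) T := by
  have ha : ∀ k, ContDiffAt ℝ ∞ (fun S : Fin 3 → ℝ => S k) T := fun k => (contDiff_apply ℝ ℝ k).contDiffAt
  have key : ∀ {f : ℝ × ℝ → ℝ}, ContDiff ℝ ∞ f → T 2 ≠ 0 →
      ContDiffAt ℝ ∞ (fun S : Fin 3 → ℝ => f (S 0 / S 2, S 1 / S 2) / S 2 ^ 2) T := by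
    intro f hf h
    exact (hf.contDiffAt.comp T (((ha 0).div (ha 2) h).prodMk ((ha 1).div (ha 2) h))).div ((ha 2).pow 2)
      (pow_ne_zero 2 h)
  rcases lt_trichotomy (T 2) 0 with h | h | h
  · refine (key hm_smooth h.ne).congr_of_eventuallyEq ?_
    filter_upwards [(isOpen_lt (continuous_apply 2) continuous_const).mem_nhds h] with S hS
    have hS : S 2 < 0 := hS
    simp [coneCoeff, hS, hS.le]
  · exact contDiffAt_const.congr_of_eventuallyEq (coneCoeff_eventually_eq_zero hp_supp hm_supp hT h)
  · refine (key hp_smooth h.ne').congr_of_eventuallyEq ?_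
    filter_upwards [(isOpen_lt continuous_const (continuous_apply 2)).mem_nhds h] with S hS
    have hS : 0 < S 2 := hS
    simp [coneCoeff, hS]

/-- The coefficient is bounded by a constant over T₂², and on the support cone |T|² is at most `(R +
1) * T 2 ^ 2`. The resulting decay |T|⁻² is what controls the error near the singular sphere. -/
theorem exists_coneCoeff_bound (hp_smooth : ContDiff ℝ ∞ fp) (hm_smooth : ContDiff ℝ ∞ fm)
    (hp_supp : HasCompactSupport fp) (hm_supp : HasCompactSupport fm) :
    ∃ C, ∀ T, |coneCoeff fp fm T| * (T 0 ^ 2 + T 1 ^ 2 + T 2 ^ 2) ≤ C := by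
  obtain ⟨R, hR, h⟩ := exists_coneCoeff_radius hp_supp hm_supp
  obtain ⟨M, hM⟩ := hp_smooth.continuous.bounded_above_of_compact_support hp_supp
  obtain ⟨M', hM'⟩ := hm_smooth.continuous.bounded_above_of_compact_support hm_supp
  have hM0 : 0 ≤ M := (norm_nonneg _).trans (hM 0)
  refine ⟨max M M' * (R + 1), fun T => ?_⟩
  by_cases h0 : coneCoeff fp fm T = 0
  · rw [h0]; simp; positivity
  have h1 : |coneCoeff fp fm T| * T 2 ^ 2 ≤ max M M' := by
    have key : ∀ f : ℝ × ℝ → ℝ, T 2 ≠ 0 →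
        |f (T 0 / T 2, T 1 / T 2) / T 2 ^ 2| * T 2 ^ 2 = ‖f (T 0 / T 2, T 1 / T 2)‖ := by
      intro f hT
      rw [abs_div, abs_of_nonneg (sq_nonneg (T 2)), div_mul_cancel₀ _ (pow_ne_zero 2 hT), Real.norm_eq_abs]
    rw [coneCoeff]
    split_ifs with h h'
    · rw [key _ h.ne']; exact (hM _).trans (le_max_left _ _)
    · rw [key _ h'.ne]; exact (hM' _).trans (le_max_right _ _)
    · simp [hM0]
  calc |coneCoeff fp fm T| * (T 0 ^ 2 + T 1 ^ 2 + T 2 ^ 2)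
      ≤ |coneCoeff fp fm T| * ((R + 1) * T 2 ^ 2) := by gcongr; linarith [h T h0]
    _ = |coneCoeff fp fm T| * T 2 ^ 2 * (R + 1) := by ring
    _ ≤ _ := by gcongr

theorem contDiffAt_coneCoeff_direction (hp_smooth : ContDiff ℝ ∞ fp) (hm_smooth : ContDiff ℝ ∞ fm)
    (hp_supp : HasCompactSupport fp) (hm_supp : HasCompactSupport fm) (Q : Matrix (Fin 4) (Fin 4) ℝ) {u : R4}
    (hu : 0 < dirNormSq (Q * affineFrame u)) :
    ContDiffAt ℝ ∞ (fun u => coneCoeff fp fm (direction (minor (Q * affineFrame u)))) u := by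
  refine ContDiffAt.comp (g := coneCoeff fp fm) (f := fun u => direction (minor (Q * affineFrame u))) u
    (contDiffAt_coneCoeff hp_smooth hm_smooth hp_supp hm_supp (direction_ne_zero hu)) ?_
  refine contDiffAt_pi.2 fun k => ?_
  fin_cases k
  exacts [(contDiff_minor Q 0 3).contDiffAt, (contDiff_minor Q 1 3).contDiffAt, (contDiff_minor Q 2 3).contDiffAt]

end ConeCoeff

theorem contDiff_dMinor (Q : Matrix (Fin 4) (Fin 4) ℝ) (i k l : Fin 4) :
    ContDiff ℝ ∞ fun u : R4 => dMinor Q u i k l := by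
  simp only [dMinor, mul_affineFrame_zero, mul_affineFrame_one]
  fun_prop

theorem contDiff_quotDiff (Q : Matrix (Fin 4) (Fin 4) ℝ) (i k : Fin 4) :
    ContDiff ℝ ∞ fun u : R4 => quotDiff (minor (Q * affineFrame u)) (dMinor Q u i) k :=
  ((contDiff_minor Q 2 3).mul (contDiff_dMinor Q i k 3)).sub
    ((contDiff_minor Q k 3).mul (contDiff_dMinor Q i 2 3))

theorem contDiffAt_chartMatrix {fp fm : ℝ × ℝ → ℝ} (hp_smooth : ContDiff ℝ ∞ fp) (hm_smooth : ContDiff ℝ ∞ fm)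
    (hp_supp : HasCompactSupport fp) (hm_supp : HasCompactSupport fm) (Q : Matrix (Fin 4) (Fin 4) ℝ) {u : R4}
    (hu : 0 < dirNormSq (Q * affineFrame u)) (i j : Fin 4) :
    ContDiffAt ℝ ∞ (fun u => chartMatrix fp fm Q u i j) u := by
  have hv := fun i k => (contDiff_quotDiff Q i k).contDiffAt (x := u)
  exact contDiffAt_const.add ((contDiffAt_coneCoeff_direction hp_smooth hm_smooth hp_supp hm_supp Q hu).mul
    (((hv i 0).mul (hv j 0)).add ((hv i 1).mul (hv j 1))))

/-! ### The charts over the two hemispheres -/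

/-- The matrix that maps the affine frames onto the frames with last row `(0, 1)` and negative direction. -/
def reflMatrix : GL (Fin 4) ℝ := Matrix.GeneralLinearGroup.mkOfDetNeZero
  !![-1, 0, 0, 0; 0, -1, 0, 0; 0, 0, -1, 0; 0, 0, 0, 1]
  (by simp [Matrix.det_succ_row_zero, Fin.sum_univ_succ])

theorem reflMatrix_val : reflMatrix.1 = !![-1, 0, 0, 0; 0, -1, 0, 0; 0, 0, -1, 0; 0, 0, 0, 1] := rfl

theorem det_reflMatrix : (reflMatrix.1).det = -1 := by
  rw [reflMatrix_val]; simp [Matrix.det_succ_row_zero, Fin.sum_univ_succ]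

/-- The change of the sign of the last two coordinates. -/
def flipLast : R4 →L[ℝ] R4 :=
  ContinuousLinearMap.pi fun i => (![1, 1, -1, -1] i : ℝ) • ContinuousLinearMap.proj i

theorem flipLast_apply (x : R4) : flipLast x = ![x 0, x 1, -x 2, -x 3] := by
  ext i; fin_cases i <;> simp [flipLast]

theorem flipLast_single (i : Fin 4) :
    flipLast (Pi.single i 1) = (![1, 1, -1, -1] i : ℝ) • (Pi.single i 1 : R4) := by
  ext j; fin_cases i <;> fin_cases j <;> simp [flipLast]

theorem flipLast_flipLast (x : R4) : flipLast (flipLast x) = x := by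
  ext i; fin_cases i <;> simp [flipLast]

theorem tdPoint_one : tdPoint 1 = (affineChart 1).symm := by
  ext x
  have h : tdFrame 1 x = (1 : GL (Fin 4) ℝ).1 * affineFrame x := by
    ext i j; fin_cases i <;> fin_cases j <;> simp [tdFrame, affineFrame]
  exact congrArg (Quotient.mk frameSetoid) (Subtype.ext h)

theorem tdPoint_neg_one (x : R4) : tdPoint (-1) x = (affineChart reflMatrix).symm (flipLast x) := by
  have h : tdFrame (-1) x = reflMatrix.1 * affineFrame (flipLast x) := by
    rw [flipLast_apply, reflMatrix_val]
    ext i j; fin_cases i <;> fin_cases j <;>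
      simp [tdFrame, affineFrame, Matrix.mul_apply, Fin.sum_univ_four]
  exact congrArg (Quotient.mk frameSetoid) (Subtype.ext h)

theorem pullbackMatrix_tdPoint_neg_one (g : FormField OGr) (x : R4) (i j : Fin 4) :
    pullbackMatrix g (tdPoint (-1)) x i j = ![1, 1, -1, -1] i * ![1, 1, -1, -1] j *
      pullbackMatrix g (affineChart reflMatrix).symm (flipLast x) i j := by
  have hf : tdPoint (-1) = (affineChart reflMatrix).symm ∘ flipLast := funext tdPoint_neg_one
  have hc := mfderiv_comp x (mdifferentiableAt_affineChart_symm reflMatrix (flipLast x))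
    (flipLast.differentiableAt (x := x)).mdifferentiableAt
  have hd : ∀ k, mfderiv 𝓘(ℝ, R4) 𝓘(ℝ, R4) ((affineChart reflMatrix).symm ∘ flipLast) x (Pi.single k 1 : R4) =
      (![1, 1, -1, -1] k : ℝ) • mfderiv 𝓘(ℝ, R4) 𝓘(ℝ, R4) (affineChart reflMatrix).symm (flipLast x)
        (Pi.single k 1 : R4) := by
    intro k
    rw [hc, mfderiv_eq_fderiv, flipLast.fderiv]
    refine Eq.trans (congrArg (mfderiv 𝓘(ℝ, R4) 𝓘(ℝ, R4) (affineChart reflMatrix).symm (flipLast x))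
      (flipLast_single k)) ?_
    exact map_smul _ _ _
  rw [hf]
  simp only [pullbackMatrix, Matrix.of_apply, hd]
  simp only [map_smul, LinearMap.smul_apply, smul_eq_mul, Function.comp_apply]
  ring

theorem chartMatrix_one (fp fm : ℝ × ℝ → ℝ) (u : R4) : chartMatrix fp fm 1 u = peteanMetric fp u := by
  ext i j
  simp only [chartMatrix, Matrix.one_mul, quotDiff, dMinor, direction, minor, coneCoeff]
  fin_cases i <;> fin_cases j <;> simp [affineFrame, peteanMetric, stdNeutral]

/-- The negative determinant reverses the flat part but not the Petean term. The coordinate change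
`flipLast` reverses the flat part once more, which leaves the Petean metric of `fm`. -/
theorem chartMatrix_reflMatrix (fp fm : ℝ × ℝ → ℝ) (u : R4) :
    chartMatrix fp fm reflMatrix.1 u = -peteanMetric (fun p => -fm p) u := by
  ext i j
  simp only [chartMatrix, det_reflMatrix, quotDiff, dMinor, direction, minor, coneCoeff, mul_affineFrame_zero,
    mul_affineFrame_one]
  rw [reflMatrix_val]
  fin_cases i <;> fin_cases j <;> simp [peteanMetric, stdNeutral]

theorem dirNormSq_affineFrame_pos (u : R4) : 0 < dirNormSq ((1 : GL (Fin 4) ℝ).1 * affineFrame u) := by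
  simp [dirNormSq, minor, affineFrame]; positivity

theorem dirNormSq_reflMatrix_pos (u : R4) : 0 < dirNormSq (reflMatrix.1 * affineFrame u) := by
  simp only [dirNormSq, minor, mul_affineFrame_zero, mul_affineFrame_one]
  rw [reflMatrix_val]
  simp; positivity

/-! ### Gram matrices, signature and choice of charts -/

theorem linearIndependent_of_gram {V : Type*} [AddCommGroup V] [Module ℝ V] (B : LinearMap.BilinForm ℝ V)
    {n : ℕ} (b : Fin n → V) {M : Matrix (Fin n) (Fin n) ℝ} (hM : M.det ≠ 0) (h : ∀ i j, B (b i) (b j) = M i j) :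
    LinearIndependent ℝ b := by
  rw [Fintype.linearIndependent_iff]
  intro c hc
  refine congrFun (Matrix.eq_zero_of_vecMul_eq_zero hM (funext fun j => ?_))
  have := congrArg (fun v => B v (b j)) hc
  simpa [Matrix.vecMul, dotProduct, h] using this

theorem pullbackMatrix_apply (g : FormField OGr) (Φ : R4 → OGr) (u v w : R4) :
    g (Φ u) (mfderiv 𝓘(ℝ, R4) 𝓘(ℝ, R4) Φ u v) (mfderiv 𝓘(ℝ, R4) 𝓘(ℝ, R4) Φ u w) =
      v ⬝ᵥ pullbackMatrix g Φ u *ᵥ w := by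
  let L : R4 →ₗ[ℝ] TangentSpace 𝓘(ℝ, R4) (Φ u) := (mfderiv 𝓘(ℝ, R4) 𝓘(ℝ, R4) Φ u).toLinearMap
  let B : LinearMap.BilinForm ℝ R4 := (g (Φ u)).compl₁₂ L L
  have h : pullbackMatrix g Φ u = LinearMap.BilinForm.toMatrix' B := by
    ext i j; simp [pullbackMatrix, B, L, LinearMap.BilinForm.toMatrix'_apply]; rfl
  rw [h, ← Matrix.toBilin'_apply', Matrix.toBilin'_toMatrix']
  rfl

theorem finrank_tangentSpace (x : OGr) : Module.finrank ℝ (TangentSpace 𝓘(ℝ, R4) x) = 4 := by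
  change Module.finrank ℝ R4 = 4
  simp

/-- The basis of the tangent space given by vectors with nondegenerate Gram matrix. -/
def basisOfGram {x : OGr} (B : LinearMap.BilinForm ℝ (TangentSpace 𝓘(ℝ, R4) x))
    (b : Fin 4 → TangentSpace 𝓘(ℝ, R4) x) {M : Matrix (Fin 4) (Fin 4) ℝ} (hM : M.det ≠ 0)
    (h : ∀ i j, B (b i) (b j) = M i j) : Module.Basis (Fin 4) ℝ (TangentSpace 𝓘(ℝ, R4) x) :=
  basisOfLinearIndependentOfCardEqFinrank (linearIndependent_of_gram B b hM h)
    (by simp [finrank_tangentSpace])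

theorem basisOfGram_apply {x : OGr} (B : LinearMap.BilinForm ℝ (TangentSpace 𝓘(ℝ, R4) x))
    (b : Fin 4 → TangentSpace 𝓘(ℝ, R4) x) {M : Matrix (Fin 4) (Fin 4) ℝ} (hM : M.det ≠ 0)
    (h : ∀ i j, B (b i) (b j) = M i j) (i : Fin 4) : basisOfGram B b hM h i = b i := by
  simp [basisOfGram]

theorem signature_of_peteanMetric {g : FormField OGr} {Φ : R4 → OGr} {u y : R4} {f : ℝ × ℝ → ℝ} {c : ℝ}
    (hc : 0 < c) (h : pullbackMatrix g Φ u = c • peteanMetric f y) :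
    ∃ b : Module.Basis (Fin 4) ℝ (TangentSpace 𝓘(ℝ, R4) (Φ u)),
      ∀ i j, g (Φ u) (b i) (b j) = if i = j then (if i < 2 then 1 else -1) else 0 := by
  obtain ⟨F, hF⟩ : ∃ F, F = f (y 0, y 1) := ⟨_, rfl⟩
  obtain ⟨k, hk⟩ : ∃ k : ℝ, k ^ 2 * c = 1 / 2 := ⟨(√(2 * c))⁻¹, by
    rw [inv_pow, Real.sq_sqrt (by positivity)]; field_simp⟩
  -- For the unscaled Petean form, eᵢ + s eᵢ₊₂ has square `F + 2 * s`. The values s = 1 - F/2 and s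
  -- = -(1 + F/2) give squares 2 and -2 and mutually orthogonal vectors; `k` absorbs the factor `2 *
  -- c`.
  let a : Fin 4 → R4 := ![![k, 0, k * (1 - F / 2), 0], ![0, k, 0, k * (1 - F / 2)],
    ![k, 0, -k * (1 + F / 2), 0], ![0, k, 0, -k * (1 + F / 2)]]
  let M : Matrix (Fin 4) (Fin 4) ℝ := Matrix.diagonal ![1, 1, -1, -1]
  have hM : M.det ≠ 0 := by simp [M, Fin.prod_univ_four]
  have hG : ∀ i j, g (Φ u) (mfderiv 𝓘(ℝ, R4) 𝓘(ℝ, R4) Φ u (a i)) (mfderiv 𝓘(ℝ, R4) 𝓘(ℝ, R4) Φ u (a j)) =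
      M i j := by
    intro i j
    rw [pullbackMatrix_apply, h]
    fin_cases i <;> fin_cases j <;>
      simp [a, M, peteanMetric, ← hF, Matrix.mulVec, dotProduct, Fin.sum_univ_four] <;>
      first | linear_combination (0 : ℝ) * hk | linear_combination (2 : ℝ) * hk | linear_combination (-2 : ℝ) * hk
  refine ⟨basisOfGram (g (Φ u)) _ hM hG, fun i j => ?_⟩
  rw [basisOfGram_apply, basisOfGram_apply, hG]
  fin_cases i <;> fin_cases j <;> simp [M]

/-- Nondegeneracy of `M` makes the images of the coordinate vectors a basis, so the matrices
determine the forms. -/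
theorem eq_smul_of_pullbackMatrix_eq {g g' : FormField OGr} {Φ : R4 → OGr} {u : R4} {c c' : ℝ}
    {M : Matrix (Fin 4) (Fin 4) ℝ} (hM : M.det ≠ 0) (hc : c' ≠ 0) (h : pullbackMatrix g Φ u = c • M)
    (h' : pullbackMatrix g' Φ u = c' • M) : g (Φ u) = (c / c') • g' (Φ u) := by
  have hM' : (c' • M).det ≠ 0 := by rw [Matrix.det_smul]; exact mul_ne_zero (pow_ne_zero _ hc) hM
  have hG : ∀ i j, g' (Φ u) (mfderiv 𝓘(ℝ, R4) 𝓘(ℝ, R4) Φ u (Pi.single i 1 : R4))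
      (mfderiv 𝓘(ℝ, R4) 𝓘(ℝ, R4) Φ u (Pi.single j 1 : R4)) = (c' • M) i j :=
    fun i j => by rw [← h']; rfl
  refine LinearMap.BilinForm.ext_basis (basisOfGram (g' (Φ u)) _ hM' hG) fun i j => ?_
  rw [basisOfGram_apply, basisOfGram_apply]
  change _ = (c / c') * _
  rw [hG]
  change pullbackMatrix g Φ u i j = _
  rw [h]
  simp only [Matrix.smul_apply, smul_eq_mul]
  field_simp

theorem det_peteanMetric (f : ℝ × ℝ → ℝ) (x : R4) : (peteanMetric f x).det = 1 := by
  simp [peteanMetric, Matrix.det_succ_row_zero, Fin.sum_univ_succ, Fin.succAbove]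

theorem det_stdNeutral : stdNeutral.det = 1 := by
  simp [stdNeutral, Matrix.det_succ_row_zero, Fin.sum_univ_succ, Fin.succAbove]

theorem det_GL_ne_zero (Q : GL (Fin 4) ℝ) : Q.1.det ≠ 0 :=
  ((Matrix.isUnit_iff_isUnit_det _).1 Q.isUnit).ne_zero

theorem rank_mul_affineFrame (Q : GL (Fin 4) ℝ) (u : R4) : (Q.1 * affineFrame u).rank = 2 := by
  rw [Matrix.rank_mul_eq_right_of_isUnit_det _ _ (det_GL_ne_zero Q).isUnit]
  exact rank_eq_two_of_minor (i := 2) (j := 3) (by simp [minor_affineFrame])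

/-- The reflection in the first coordinate. -/
def reflFirst : GL (Fin 4) ℝ := Matrix.GeneralLinearGroup.mkOfDetNeZero
  !![-1, 0, 0, 0; 0, 1, 0, 0; 0, 0, 1, 0; 0, 0, 0, 1]
  (by simp [Matrix.det_succ_row_zero, Fin.sum_univ_succ])

theorem reflFirst_val : reflFirst.1 = !![-1, 0, 0, 0; 0, 1, 0, 0; 0, 0, 1, 0; 0, 0, 0, 1] := rfl

theorem reflFirst_inv : reflFirst⁻¹ = reflFirst := by
  refine inv_eq_of_mul_eq_one_left (Units.ext ?_)
  rw [Units.val_mul, reflFirst_val]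
  ext i j; fin_cases i <;> fin_cases j <;> simp [Matrix.mul_apply, Fin.sum_univ_four]

theorem reflMatrix_inv : reflMatrix⁻¹ = reflMatrix := by
  refine inv_eq_of_mul_eq_one_left (Units.ext ?_)
  rw [Units.val_mul, reflMatrix_val]
  ext i j; fin_cases i <;> fin_cases j <;> simp [Matrix.mul_apply, Fin.sum_univ_four]

/-- Composing with the reflection of the first coordinate changes the sign of the determinant but
not the chart domain, which depends only on the last two rows. On the wall a positive determinant
gives a positive multiple of `stdNeutral`. -/
theorem exists_affineChart_det_pos (x : OGr) : ∃ Q : GL (Fin 4) ℝ, 0 < Q.1.det ∧ x ∈ (affineChart Q).source := by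
  obtain ⟨Q, hQ⟩ := exists_mem_affineChart_source x
  rcases (det_GL_ne_zero Q).lt_or_gt with h | h
  · obtain ⟨A, hA⟩ := x
    change OGr.mk A hA ∈ _ at hQ
    refine ⟨Q * reflFirst, ?_, ?_⟩
    · have hd : reflFirst.1.det = -1 := by
        rw [reflFirst_val]; simp [Matrix.det_succ_row_zero, Fin.sum_univ_succ]
      rw [Units.val_mul, Matrix.det_mul, hd]; linarith
    · change OGr.mk A hA ∈ _
      rw [mem_affineChart_source] at hQ ⊢
      rw [mul_inv_rev, reflFirst_inv, Units.val_mul, Matrix.mul_assoc, reflFirst_val]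
      generalize (Q⁻¹).1 * A = B at hQ ⊢
      simpa [minor, Matrix.mul_apply, Fin.sum_univ_four] using hQ
  · exact ⟨Q, h, hQ⟩

theorem exists_affineChart_one {A : Matrix (Fin 4) (Fin 2) ℝ} (hA : A.rank = 2) (h : 0 < minor A 2 3) :
    ∃ u, OGr.mk A hA = (affineChart 1).symm u := by
  have hs : OGr.mk A hA ∈ (affineChart 1).source := by
    rw [mem_affineChart_source]; simpa using h
  exact ⟨_, ((affineChart 1).left_inv hs).symm⟩

theorem exists_affineChart_reflMatrix {A : Matrix (Fin 4) (Fin 2) ℝ} (hA : A.rank = 2) (h : minor A 2 3 < 0) :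
    ∃ u, OGr.mk A hA = (affineChart reflMatrix).symm u := by
  have hs : OGr.mk A hA ∈ (affineChart reflMatrix).source := by
    rw [mem_affineChart_source, reflMatrix_inv, reflMatrix_val]
    simp [minor, Matrix.mul_apply, Fin.sum_univ_four] at h ⊢
    linarith
  exact ⟨_, ((affineChart reflMatrix).left_inv hs).symm⟩

theorem coneCoeff_eq_zero (fp fm : ℝ × ℝ → ℝ) {T : Fin 3 → ℝ} (h : T 2 = 0) : coneCoeff fp fm T = 0 := by
  simp [coneCoeff, h]

theorem chartMatrix_of_minor_eq_zero (fp fm : ℝ × ℝ → ℝ) (Q : Matrix (Fin 4) (Fin 4) ℝ) {u : R4}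
    (h : minor (Q * affineFrame u) 2 3 = 0) : chartMatrix fp fm Q u = Q.det • stdNeutral := by
  ext i j
  simp [chartMatrix, coneCoeff_eq_zero fp fm (T := direction (minor (Q * affineFrame u))) h]

/-- The covectors `quotDiff` are null for the flat metric, so the Petean term is trace-free. Hence
the trace recovers the conformal factor of a multiple of `chartMatrix`, smoothly and without
knowledge of the coefficient. -/
theorem chartMatrix_trace (fp fm : ℝ × ℝ → ℝ) (Q : Matrix (Fin 4) (Fin 4) ℝ) (u : R4) :
    chartMatrix fp fm Q u 0 2 + chartMatrix fp fm Q u 1 3 = 2 * Q.det := by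
  simp only [chartMatrix, Matrix.of_apply, quotDiff, dMinor, minor]
  generalize coneCoeff _ _ _ = K
  generalize Q * affineFrame u = N
  simp [stdNeutral]
  ring

/-! ### Existence of the induced metric and its uniqueness up to a positive factor -/

section Induced

variable {fp fm : ℝ × ℝ → ℝ}

theorem pullbackMatrix_inducedMetric_one (fp fm : ℝ × ℝ → ℝ) (u : R4) :
    pullbackMatrix (inducedMetric fp fm) (tdPoint 1) u =
      (dirNormSq ((1 : GL (Fin 4) ℝ).1 * affineFrame u))⁻¹ • peteanMetric fp u := by
  rw [tdPoint_one, pullbackMatrix_inducedMetric fp fm 1 (dirNormSq_affineFrame_pos u)]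
  exact congrArg _ (chartMatrix_one fp fm u)

theorem pullbackMatrix_inducedMetric_neg_one (fp fm : ℝ × ℝ → ℝ) (u : R4) :
    pullbackMatrix (inducedMetric fp fm) (tdPoint (-1)) u =
      (dirNormSq (reflMatrix.1 * affineFrame (flipLast u)))⁻¹ • peteanMetric fm u := by
  ext i j
  rw [pullbackMatrix_tdPoint_neg_one,
    pullbackMatrix_inducedMetric fp fm _ (dirNormSq_reflMatrix_pos _), chartMatrix_reflMatrix]
  generalize dirNormSq _ = c
  rw [flipLast_apply]
  fin_cases i <;> fin_cases j <;> simp [peteanMetric]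

theorem isNeutralMetricOn_inducedMetric (hp_smooth : ContDiff ℝ ∞ fp) (hm_smooth : ContDiff ℝ ∞ fm)
    (hp_supp : HasCompactSupport fp) (hm_supp : HasCompactSupport fm) :
    IsNeutralMetricOn (inducedMetric fp fm) TS2 := by
  rw [TS2_eq_compl]
  refine ⟨isClosed_S2inf.isOpen_compl, ?_, ?_, ?_⟩
  · intro x _ v w
    change inducedForm _ _ _ _ _ = inducedForm _ _ _ _ _
    simp only [inducedForm, plForm]; ring
  · intro x hx
    obtain ⟨Q, hQ, hxQ⟩ := exists_affineChart_det_pos x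
    obtain ⟨u, rfl⟩ : ∃ u, x = (affineChart Q).symm u := ⟨_, ((affineChart Q).left_inv hxQ).symm⟩
    rw [affineChart_symm_mem_S2inf_compl] at hx
    have hA := rank_mul_affineFrame Q u
    rcases lt_trichotomy (minor (Q.1 * affineFrame u) 2 3) 0 with h | h | h
    · obtain ⟨w, hw⟩ := exists_affineChart_reflMatrix hA h
      rw [affineChart_symm_apply Q u hA, hw, ← flipLast_flipLast w, ← tdPoint_neg_one]
      exact signature_of_peteanMetric (inv_pos.2 (dirNormSq_reflMatrix_pos _))
        (pullbackMatrix_inducedMetric_neg_one fp fm _)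
    · refine signature_of_peteanMetric (f := 0) (y := u)
        (c := (dirNormSq (Q.1 * affineFrame u))⁻¹ * Q.1.det) (by positivity) ?_
      rw [pullbackMatrix_inducedMetric fp fm Q hx, chartMatrix_of_minor_eq_zero fp fm _ h, smul_smul]
      rfl
    · obtain ⟨w, hw⟩ := exists_affineChart_one hA h
      rw [affineChart_symm_apply Q u hA, hw, ← tdPoint_one]
      exact signature_of_peteanMetric (inv_pos.2 (dirNormSq_affineFrame_pos _))
        (pullbackMatrix_inducedMetric_one fp fm _)
  · rintro _ ⟨Q, rfl⟩ i j u ⟨-, hu⟩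
    have hu' := (affineChart_symm_mem_S2inf_compl Q u).1 hu
    refine ContDiffAt.contDiffWithinAt ?_
    refine ContDiffAt.congr_of_eventuallyEq (f := fun u => (dirNormSq (Q.1 * affineFrame u))⁻¹ *
      chartMatrix fp fm Q.1 u i j) (((contDiff_dirNormSq _).contDiffAt.inv hu'.ne').mul
        (contDiffAt_chartMatrix hp_smooth hm_smooth hp_supp hm_supp _ hu' i j)) ?_
    filter_upwards [(isOpen_lt continuous_const (contDiff_dirNormSq Q.1).continuous).mem_nhds hu'] with w hw
    rw [pullbackMatrix_inducedMetric fp fm Q hw]; rfl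

theorem isInduced_inducedMetric (hp_smooth : ContDiff ℝ ∞ fp) (hm_smooth : ContDiff ℝ ∞ fm)
    (hp_supp : HasCompactSupport fp) (hm_supp : HasCompactSupport fm) :
    IsInduced fp fm (inducedMetric fp fm) where
  neutral := isNeutralMetricOn_inducedMetric hp_smooth hm_smooth hp_supp hm_supp
  plus x := ⟨_, inv_pos.2 (dirNormSq_affineFrame_pos _), pullbackMatrix_inducedMetric_one fp fm x⟩
  minus x := ⟨_, inv_pos.2 (dirNormSq_reflMatrix_pos _), pullbackMatrix_inducedMetric_neg_one fp fm x⟩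

theorem IsInduced.exists_eq_smul {g : FormField OGr} (hg : IsInduced fp fm g) (Q : GL (Fin 4) ℝ) {u : R4}
    (h : minor (Q.1 * affineFrame u) 2 3 ≠ 0) :
    ∃ c : ℝ, 0 < c ∧ g ((affineChart Q).symm u) = c • inducedMetric fp fm ((affineChart Q).symm u) := by
  have hA := rank_mul_affineFrame Q u
  rw [affineChart_symm_apply Q u hA]
  rcases h.lt_or_gt with h | h
  · obtain ⟨w, hw⟩ := exists_affineChart_reflMatrix hA h
    rw [hw, ← flipLast_flipLast w, ← tdPoint_neg_one]
    obtain ⟨c, hc, hcg⟩ := hg.minus (flipLast w)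
    have hN := inv_pos.2 (dirNormSq_reflMatrix_pos (flipLast (flipLast w)))
    exact ⟨_, div_pos hc hN, eq_smul_of_pullbackMatrix_eq (by rw [det_peteanMetric]; exact one_ne_zero) hN.ne' hcg
      (pullbackMatrix_inducedMetric_neg_one fp fm _)⟩
  · obtain ⟨w, hw⟩ := exists_affineChart_one hA h
    rw [hw, ← tdPoint_one]
    obtain ⟨c, hc, hcg⟩ := hg.plus w
    have hN := inv_pos.2 (dirNormSq_affineFrame_pos w)
    exact ⟨_, div_pos hc hN, eq_smul_of_pullbackMatrix_eq (by rw [det_peteanMetric]; exact one_ne_zero) hN.ne' hcg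
      (pullbackMatrix_inducedMetric_one fp fm _)⟩

/-- The trace with respect to `stdNeutral` of the matrix of `g` in a chart, suitably normalized. -/
def chartFactor (g : FormField OGr) (Q : GL (Fin 4) ℝ) (u : R4) : ℝ :=
  (pullbackMatrix g (affineChart Q).symm u 0 2 + pullbackMatrix g (affineChart Q).symm u 1 3) / (2 * Q.1.det)

theorem chartFactor_eq {g : FormField OGr} {Q : GL (Fin 4) ℝ} {u : R4} {c : ℝ}
    (h : pullbackMatrix g (affineChart Q).symm u = c • chartMatrix fp fm Q.1 u) : chartFactor g Q u = c := by
  have hQ := det_GL_ne_zero Q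
  rw [chartFactor, h, Matrix.smul_apply, Matrix.smul_apply, ← smul_add, chartMatrix_trace, smul_eq_mul]
  field_simp

theorem contDiffAt_pullbackMatrix {g : FormField OGr} (hg : IsNeutralMetricOn g TS2) (Q : GL (Fin 4) ℝ) {u : R4}
    (hu : 0 < dirNormSq (Q.1 * affineFrame u)) (i j : Fin 4) :
    ContDiffAt ℝ ∞ (fun u => pullbackMatrix g (affineChart Q).symm u i j) u := by
  refine (hg.smooth _ (mem_range_self Q) i j).contDiffAt (mem_nhds_iff.2
    ⟨{u | 0 < dirNormSq (Q.1 * affineFrame u)}, fun w hw => ?_,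
      isOpen_lt continuous_const (contDiff_dirNormSq Q.1).continuous, hu⟩)
  rw [TS2_eq_compl]
  exact ⟨by simp [affineChart_target], (affineChart_symm_mem_S2inf_compl Q w).2 hw⟩

theorem contDiffAt_chartFactor {g : FormField OGr} (hg : IsNeutralMetricOn g TS2) (Q : GL (Fin 4) ℝ) {u : R4}
    (hu : 0 < dirNormSq (Q.1 * affineFrame u)) : ContDiffAt ℝ ∞ (chartFactor g Q) u :=
  ((contDiffAt_pullbackMatrix hg Q hu 0 2).add (contDiffAt_pullbackMatrix hg Q hu 1 3)).div_const _

theorem pullbackMatrix_smul {g g' : FormField OGr} {Φ : R4 → OGr} {u : R4} {c : ℝ} (h : g (Φ u) = c • g' (Φ u)) :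
    pullbackMatrix g Φ u = c • pullbackMatrix g' Φ u := by
  ext i j
  simp only [pullbackMatrix, Matrix.of_apply, h]
  rfl

/-- The wall T₂ = 0 has dense complement away from the singular sphere, which is what the passage to
the limit in `IsInduced.pullbackMatrix_eq` requires. -/
theorem exists_tendsto_minor_ne_zero (Q : GL (Fin 4) ℝ) {u : R4} (hu : 0 < dirNormSq (Q.1 * affineFrame u))
    (h : minor (Q.1 * affineFrame u) 2 3 = 0) :
    ∃ γ : ℝ → R4, Tendsto γ (𝓝[≠] 0) (𝓝 u) ∧ ∀ᶠ s in 𝓝[≠] 0, minor (Q.1 * affineFrame (γ s)) 2 3 ≠ 0 := by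
  set A := Q.1 * affineFrame u with hA
  have hA' : 0 < A 3 0 ^ 2 + A 3 1 ^ 2 := by
    by_contra hc
    have h0 : A 3 0 = 0 := by nlinarith [sq_nonneg (A 3 0), sq_nonneg (A 3 1)]
    have h1 : A 3 1 = 0 := by nlinarith [sq_nonneg (A 3 0), sq_nonneg (A 3 1)]
    simp [dirNormSq, minor, h0, h1] at hu
  -- Moving the third row along the last row turned by a right angle makes the minor of these two
  -- rows grow linearly in `s`.
  let B : ℝ → Matrix (Fin 4) (Fin 2) ℝ := fun s => A + s • !![0, 0; 0, 0; A 3 1, -A 3 0; 0, 0]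
  have hB : ∀ s, minor (B s) 2 3 = s * (A 3 0 ^ 2 + A 3 1 ^ 2) := by
    intro s
    rw [minor] at h
    simp [B, minor]; linear_combination h
  have hc : ∀ i j, Continuous fun s => minor ((Q⁻¹).1 * B s) i j := by
    intro i j
    simp only [minor, B, Matrix.mul_apply, Fin.sum_univ_four, Matrix.add_apply, Matrix.smul_apply, smul_eq_mul]
    fun_prop
  have hB0 : (Q⁻¹).1 * B 0 = affineFrame u := by
    simp only [B, zero_smul, add_zero, hA]
    rw [← Matrix.mul_assoc, ← Units.val_mul, inv_mul_cancel, Units.val_one, Matrix.one_mul]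
  have h1 : minor ((Q⁻¹).1 * B 0) 2 3 ≠ 0 := by rw [hB0, minor_affineFrame]; exact one_ne_zero
  refine ⟨fun s => affineCoord ((Q⁻¹).1 * B s), ?_, ?_⟩
  · refine Tendsto.mono_left ?_ nhdsWithin_le_nhds
    have : ContinuousAt (fun s => affineCoord ((Q⁻¹).1 * B s)) 0 := by
      refine continuousAt_pi.2 fun k => ?_
      have hd : ∀ i j, ContinuousAt (fun s => minor ((Q⁻¹).1 * B s) i j / minor ((Q⁻¹).1 * B s) 2 3) 0 :=
        fun i j => (hc i j).continuousAt.div (hc 2 3).continuousAt h1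
      fin_cases k
      exacts [hd 0 3, hd 1 3, hd 2 1, hd 0 2]
    have h2 := this.tendsto
    simp only [hB0, affineCoord_affineFrame] at h2
    exact h2
  · filter_upwards [self_mem_nhdsWithin, mem_nhdsWithin_of_mem_nhds
      ((isOpen_ne.preimage (hc 2 3)).mem_nhds h1)] with s hs hs'
    have e := congrArg (fun X => minor (Q.1 * X) 2 3) (affineFrame_affineCoord hs')
    rw [← Matrix.mul_assoc, minor_mul, ← Matrix.mul_assoc, ← Units.val_mul, mul_inv_cancel, Units.val_one,
      Matrix.one_mul, hB] at e
    intro h0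
    rw [h0, zero_mul] at e
    exact mul_ne_zero hs hA'.ne' e.symm

/-- Off the wall this is the hypothesis on the two hemispheres. On the wall both sides are
continuous, so the equation passes to the limit. -/
theorem IsInduced.pullbackMatrix_eq {g : FormField OGr} (hg : IsInduced fp fm g) (hp_smooth : ContDiff ℝ ∞ fp)
    (hm_smooth : ContDiff ℝ ∞ fm) (hp_supp : HasCompactSupport fp) (hm_supp : HasCompactSupport fm)
    (Q : GL (Fin 4) ℝ) {u : R4} (hu : 0 < dirNormSq (Q.1 * affineFrame u)) : 0 < chartFactor g Q u ∧
      pullbackMatrix g (affineChart Q).symm u = chartFactor g Q u • chartMatrix fp fm Q.1 u := by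
  have key : ∀ w, 0 < dirNormSq (Q.1 * affineFrame w) → minor (Q.1 * affineFrame w) 2 3 ≠ 0 →
      0 < chartFactor g Q w ∧
        pullbackMatrix g (affineChart Q).symm w = chartFactor g Q w • chartMatrix fp fm Q.1 w := by
    intro w hw h
    obtain ⟨c, hc, hcg⟩ := hg.exists_eq_smul Q h
    have e := pullbackMatrix_smul hcg
    rw [pullbackMatrix_inducedMetric fp fm Q hw, smul_smul] at e
    rw [chartFactor_eq e]
    exact ⟨mul_pos hc (inv_pos.2 hw), e⟩
  by_cases h : minor (Q.1 * affineFrame u) 2 3 = 0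
  swap
  · exact key u hu h
  obtain ⟨γ, hγ, hγ'⟩ := exists_tendsto_minor_ne_zero Q hu h
  have hev : ∀ᶠ s in 𝓝[≠] 0, 0 < chartFactor g Q (γ s) ∧
      pullbackMatrix g (affineChart Q).symm (γ s) = chartFactor g Q (γ s) • chartMatrix fp fm Q.1 (γ s) := by
    filter_upwards [hγ', hγ.eventually ((isOpen_lt continuous_const (contDiff_dirNormSq Q.1).continuous).mem_nhds
      hu)] with s h1 h2 using key _ h2 h1
  have hcf := (contDiffAt_chartFactor hg.neutral Q hu).continuousAt
  have heq : pullbackMatrix g (affineChart Q).symm u = chartFactor g Q u • chartMatrix fp fm Q.1 u := by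
    ext i j
    have t1 := (contDiffAt_pullbackMatrix hg.neutral Q hu i j).continuousAt.tendsto.comp hγ
    have t2 := (hcf.mul (contDiffAt_chartMatrix hp_smooth hm_smooth hp_supp hm_supp Q.1 hu i j).continuousAt).tendsto.comp hγ
    refine tendsto_nhds_unique t1 (t2.congr' ?_)
    filter_upwards [hev] with s hs
    simp [hs.2]
  refine ⟨?_, heq⟩
  -- Positivity survives the limit only as nonnegativity. A zero factor would make `g` vanish at the
  -- point, against its signature.
  have hnn : 0 ≤ chartFactor g Q u := ge_of_tendsto (hcf.tendsto.comp hγ) (hev.mono fun s hs => hs.1.le)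
  refine hnn.lt_of_ne' fun h0 => ?_
  have hdet : (chartMatrix fp fm Q.1 u).det ≠ 0 := by
    rw [chartMatrix_of_minor_eq_zero fp fm _ h, Matrix.det_smul, det_stdNeutral, mul_one]
    exact pow_ne_zero _ (det_GL_ne_zero Q)
  have hz := eq_smul_of_pullbackMatrix_eq hdet (inv_pos.2 hu).ne' heq (pullbackMatrix_inducedMetric fp fm Q hu)
  rw [h0, zero_div, zero_smul] at hz
  obtain ⟨b, hb⟩ := hg.neutral.signature ((affineChart Q).symm u)
    (by rw [TS2_eq_compl]; exact (affineChart_symm_mem_S2inf_compl Q u).2 hu)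
  have := hb 0 0
  rw [hz] at this
  simp at this

end Induced

/-! ### Locality of the Weyl condition and its invariance under a change of sign -/

section Congr

variable {G G' : R4 → Matrix (Fin 4) (Fin 4) ℝ} {u : R4}

theorem pderiv4_congr {F F' : R4 → ℝ} (h : F =ᶠ[𝓝 u] F') (i : Fin 4) : pderiv4 i F u = pderiv4 i F' u := by
  rw [pderiv4, pderiv4, h.fderiv_eq]

theorem christoffel_congr (h : G =ᶠ[𝓝 u] G') (l i j : Fin 4) : christoffel G l i j u = christoffel G' l i j u := by
  have hd : ∀ a b c, pderiv4 a (fun w => G w b c) u = pderiv4 a (fun w => G' w b c) u := fun a b c =>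
    pderiv4_congr (h.mono fun w hw => by simp only [hw]) a
  simp only [christoffel, hd, h.self_of_nhds]

theorem riemannUp_congr (h : G =ᶠ[𝓝 u] G') (l k i j : Fin 4) : riemannUp G l k i j u = riemannUp G' l k i j u := by
  have hc : ∀ a b c, christoffel G a b c =ᶠ[𝓝 u] christoffel G' a b c := fun a b c =>
    h.eventually_nhds.mono fun w hw => christoffel_congr hw a b c
  simp only [riemannUp, pderiv4_congr (hc _ _ _), (hc _ _ _).self_of_nhds]

theorem weyl_congr (h : G =ᶠ[𝓝 u] G') (l k i j : Fin 4) : weyl G l k i j u = weyl G' l k i j u := by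
  simp only [weyl, scalarCurv, ricci, riemannDown, riemannUp_congr h, h.self_of_nhds]

theorem WeylSelfDualAt.congr (hG : WeylSelfDualAt G' u) (h : G =ᶠ[𝓝 u] G') : WeylSelfDualAt G u := by
  intro l k i j
  have := hG l k i j
  simpa only [weyl_congr h, h.self_of_nhds] using this

theorem inv_neg_matrix (A : Matrix (Fin 4) (Fin 4) ℝ) : (-A)⁻¹ = -A⁻¹ := by
  by_cases hA : IsUnit A.det
  · exact Matrix.inv_eq_right_inv (by rw [neg_mul_neg, Matrix.mul_nonsing_inv _ hA])
  -- A singular matrix has inverse zero by convention, and so has its negative.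
  · rw [Matrix.nonsing_inv_apply_not_isUnit _ hA, Matrix.nonsing_inv_apply_not_isUnit, neg_zero]
    rwa [Matrix.det_neg, Fintype.card_fin, show ((-1 : ℝ) ^ 4) = 1 by norm_num, one_mul]

/-- The connection and `riemannUp` do not change under `G ↦ -G`, so the lowered Weyl tensor changes
sign. The Hodge star on 2-forms contains two inverse metrics and is unchanged. -/
theorem WeylSelfDualAt.neg (hG : WeylSelfDualAt G u) : WeylSelfDualAt (fun w => -G w) u := by
  have hd : ∀ a b c w, pderiv4 a (fun w => -G w b c) w = -pderiv4 a (fun w => G w b c) w := fun a b c w => by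
    simp [pderiv4, fderiv_fun_neg]
  have hc : ∀ l i j, christoffel (fun w => -G w) l i j = christoffel G l i j := fun l i j => by
    ext w
    simp only [christoffel, inv_neg_matrix, Matrix.neg_apply, hd]
    refine congrArg _ (Finset.sum_congr rfl fun m _ => by ring)
  have hr : ∀ l k i j, riemannUp (fun w => -G w) l k i j = riemannUp G l k i j := fun l k i j => by
    ext w; simp only [riemannUp, hc]
  have hs : scalarCurv (fun w => -G w) u = -scalarCurv G u := by
    simp only [scalarCurv, ricci, hr, inv_neg_matrix, Matrix.neg_apply, neg_mul, Finset.sum_neg_distrib]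
  have hw : ∀ l k i j, weyl (fun w => -G w) l k i j u = -weyl G l k i j u := fun l k i j => by
    simp only [weyl, hs, riemannDown, ricci, hr, Matrix.neg_apply, neg_mul, Finset.sum_neg_distrib]
    ring
  intro l k i j
  have hdet : (-G u).det = (G u).det := by
    rw [Matrix.det_neg, Fintype.card_fin, show ((-1 : ℝ) ^ 4) = 1 by norm_num, one_mul]
  simp only [hw, hdet, inv_neg_matrix, Matrix.neg_apply, mul_neg, neg_mul, neg_neg, Finset.sum_neg_distrib]
  rw [hG l k i j]

end Congr

/-! ### Curvature of Petean metrics -/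

section Petean

theorem inv_peteanMetric (f : ℝ × ℝ → ℝ) (u : R4) : (peteanMetric f u)⁻¹ =
    !![0, 0, 1, 0; 0, 0, 0, 1; 1, 0, -f (u 0, u 1), 0; 0, 1, 0, -f (u 0, u 1)] := by
  refine Matrix.inv_eq_right_inv ?_
  ext i j; fin_cases i <;> fin_cases j <;> simp [peteanMetric, Matrix.mul_apply, Fin.sum_univ_four]

/-- The partial derivatives of `f (x₁, x₂)`. -/
def planeDeriv (f : ℝ × ℝ → ℝ) (i : Fin 4) : R4 → ℝ := pderiv4 i fun w => f (w 0, w 1)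

variable {f : ℝ × ℝ → ℝ}

theorem pderiv4_const (i : Fin 4) (c : ℝ) (u : R4) : pderiv4 i (fun _ => c) u = 0 := by
  simp [pderiv4]

theorem pderiv4_peteanMetric (u : R4) (i m j : Fin 4) : pderiv4 i (fun w => peteanMetric f w m j) u =
    !![1, 0, 0, 0; 0, 1, 0, 0; 0, 0, 0, 0; 0, 0, 0, 0] m j * planeDeriv f i u := by
  fin_cases m <;> fin_cases j <;> simp [peteanMetric, planeDeriv, pderiv4_const]

theorem contDiff_plane (hf : ContDiff ℝ ∞ f) : ContDiff ℝ ∞ fun w : R4 => f (w 0, w 1) := by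
  fun_prop

theorem planeDeriv_eq (hf : ContDiff ℝ ∞ f) (i : Fin 4) (u : R4) : planeDeriv f i u =
    fderiv ℝ f (u 0, u 1) ((Pi.single i 1 : R4) 0, (Pi.single i 1 : R4) 1) := by
  have h1 : HasFDerivAt (fun w : R4 => (w 0, w 1)) ((ContinuousLinearMap.proj (R := ℝ) (φ := fun _ : Fin 4 => ℝ) 0).prod
    (ContinuousLinearMap.proj (R := ℝ) (φ := fun _ : Fin 4 => ℝ) 1)) u :=
    (hasFDerivAt_apply 0 u).prodMk (hasFDerivAt_apply 1 u)
  have h2 : HasFDerivAt f (fderiv ℝ f (u 0, u 1)) (u 0, u 1) :=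
    ((hf.differentiable (by simp)) _).hasFDerivAt
  have h3 := HasFDerivAt.comp (f := fun w : R4 => (w 0, w 1)) u h2 h1
  rw [planeDeriv, pderiv4]
  erw [h3.fderiv]
  rfl

theorem planeDeriv_two (hf : ContDiff ℝ ∞ f) : planeDeriv f 2 = 0 := by
  ext u; rw [planeDeriv_eq hf]; exact map_zero (fderiv ℝ f (u 0, u 1))

theorem planeDeriv_three (hf : ContDiff ℝ ∞ f) : planeDeriv f 3 = 0 := by
  ext u; rw [planeDeriv_eq hf]; exact map_zero (fderiv ℝ f (u 0, u 1))

theorem differentiable_planeDeriv (hf : ContDiff ℝ ∞ f) (i : Fin 4) : Differentiable ℝ (planeDeriv f i) := by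
  have h : ContDiff ℝ 1 (fderiv ℝ fun w : R4 => f (w 0, w 1)) :=
    (contDiff_plane hf).fderiv_right (by norm_cast)
  exact (h.clm_apply contDiff_const).differentiable (by simp)

theorem pderiv4_planeDeriv_comm (hf : ContDiff ℝ ∞ f) (i j : Fin 4) (u : R4) :
    pderiv4 i (planeDeriv f j) u = pderiv4 j (planeDeriv f i) u := by
  have h : ContDiff ℝ 1 (fderiv ℝ fun w : R4 => f (w 0, w 1)) :=
    (contDiff_plane hf).fderiv_right (by norm_cast)
  have hd : ∀ v : R4, fderiv ℝ (fun w => fderiv ℝ (fun w : R4 => f (w 0, w 1)) w v) u =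
      (fderiv ℝ (fderiv ℝ fun w : R4 => f (w 0, w 1)) u).flip v := fun v => by
    rw [fderiv_clm_apply (h.differentiable (by simp) u) (differentiableAt_const v)]
    ext; simp
  have hs : IsSymmSndFDerivAt ℝ (fun w : R4 => f (w 0, w 1)) u :=
    (contDiff_plane hf).contDiffAt.isSymmSndFDerivAt (by
      rw [minSmoothness_of_isRCLikeNormedField]; exact WithTop.coe_le_coe.2 (le_top : (2 : ℕ∞) ≤ ⊤))
  change fderiv ℝ (fun w => fderiv ℝ (fun w : R4 => f (w 0, w 1)) w (Pi.single j 1)) u (Pi.single i 1) =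
    fderiv ℝ (fun w => fderiv ℝ (fun w : R4 => f (w 0, w 1)) w (Pi.single i 1)) u (Pi.single j 1)
  rw [hd, hd]
  exact hs _ _

theorem pderiv4_planeDeriv_of_two_le (hf : ContDiff ℝ ∞ f) (i : Fin 4) (u : R4) :
    pderiv4 2 (planeDeriv f i) u = 0 ∧ pderiv4 3 (planeDeriv f i) u = 0 := by
  rw [pderiv4_planeDeriv_comm hf, pderiv4_planeDeriv_comm hf 3, planeDeriv_two hf, planeDeriv_three hf]
  exact ⟨pderiv4_const i 0 u, pderiv4_const i 0 u⟩

/-- The coefficient of `∂f/∂xₙ` in the Christoffel symbol `Γˡᵢⱼ` of Petean's metric. -/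
def peteanSymbol (n : Fin 2) (l i j : Fin 4) : ℝ :=
  ![![0, 0, !![1/2, 0, 0, 0; 0, -1/2, 0, 0; 0, 0, 0, 0; 0, 0, 0, 0],
      !![0, 1/2, 0, 0; 1/2, 0, 0, 0; 0, 0, 0, 0; 0, 0, 0, 0]],
    ![0, 0, !![0, 1/2, 0, 0; 1/2, 0, 0, 0; 0, 0, 0, 0; 0, 0, 0, 0],
      !![-1/2, 0, 0, 0; 0, 1/2, 0, 0; 0, 0, 0, 0; 0, 0, 0, 0]]] n l i j

theorem christoffel_peteanMetric (hf : ContDiff ℝ ∞ f) (l i j : Fin 4) : christoffel (peteanMetric f) l i j =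
    fun u => peteanSymbol 0 l i j * planeDeriv f 0 u + peteanSymbol 1 l i j * planeDeriv f 1 u := by
  ext u
  simp only [christoffel, inv_peteanMetric, pderiv4_peteanMetric, Fin.sum_univ_four]
  have h2 := congrFun (planeDeriv_two hf) u
  have h3 := congrFun (planeDeriv_three hf) u
  fin_cases l <;> fin_cases i <;> fin_cases j <;> simp [peteanSymbol, h2, h3] <;> ring

theorem pderiv4_christoffel_peteanMetric (hf : ContDiff ℝ ∞ f) (a l i j : Fin 4) (u : R4) :
    pderiv4 a (christoffel (peteanMetric f) l i j) u =
      peteanSymbol 0 l i j * pderiv4 a (planeDeriv f 0) u + peteanSymbol 1 l i j * pderiv4 a (planeDeriv f 1) u := by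
  have hd := fun n => differentiable_planeDeriv hf n u
  rw [christoffel_peteanMetric hf, pderiv4, fderiv_fun_add ((hd 0).const_mul _) ((hd 1).const_mul _),
    fderiv_const_mul (hd 0), fderiv_const_mul (hd 1)]
  rfl

/-- The area form `dx₁ ∧ dx₂`. -/
def planeArea : Matrix (Fin 4) (Fin 4) ℝ := !![0, 1, 0, 0; -1, 0, 0, 0; 0, 0, 0, 0; 0, 0, 0, 0]

/-- Half of the Laplacian of `f`. -/
def halfLaplacian (f : ℝ × ℝ → ℝ) (u : R4) : ℝ :=
  (pderiv4 0 (planeDeriv f 0) u + pderiv4 1 (planeDeriv f 1) u) / 2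

/-- The quadratic Christoffel terms vanish, so the curvature is linear in the second derivatives of
`f`; the antisymmetrization leaves only the Laplacian. -/
theorem riemannUp_peteanMetric (hf : ContDiff ℝ ∞ f) (l k i j : Fin 4) (u : R4) :
    riemannUp (peteanMetric f) l k i j u = -halfLaplacian f u *
      (!![0, 0, 0, 0; 0, 0, 0, 0; 0, 1, 0, 0; -1, 0, 0, 0] l k * planeArea i j) := by
  -- The symbols have upper index in {2, 3} and lower indices in {0, 1}, so no contracted index `m`
  -- contributes.
  have hs : ∀ n n' m a b c d, peteanSymbol n l a m * peteanSymbol n' m b c * d = 0 := by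
    intro n n' m a b c d
    fin_cases m
    · simp [peteanSymbol]; fin_cases n' <;> simp
    · simp [peteanSymbol]; fin_cases n' <;> simp
    · fin_cases n <;> fin_cases l <;> fin_cases a <;> simp [peteanSymbol]
    · fin_cases n <;> fin_cases l <;> fin_cases a <;> simp [peteanSymbol]
  have hz : ∀ a b c d m, christoffel (peteanMetric f) l a m u * christoffel (peteanMetric f) m b c u
      = d * 0 := by
    intro a b c d m
    rw [christoffel_peteanMetric hf, christoffel_peteanMetric hf]
    linear_combination hs 0 0 m a b c (planeDeriv f 0 u * planeDeriv f 0 u)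
      + hs 0 1 m a b c (planeDeriv f 0 u * planeDeriv f 1 u)
      + hs 1 0 m a b c (planeDeriv f 1 u * planeDeriv f 0 u)
      + hs 1 1 m a b c (planeDeriv f 1 u * planeDeriv f 1 u)
  rw [riemannUp, pderiv4_christoffel_peteanMetric hf, pderiv4_christoffel_peteanMetric hf,
    Finset.sum_eq_zero fun m _ => by rw [hz i j k 0, hz j i k 0]; ring]
  have h0 := pderiv4_planeDeriv_of_two_le hf 0 u
  have h1 := pderiv4_planeDeriv_of_two_le hf 1 u
  have h2 := pderiv4_planeDeriv_comm hf 1 0 u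
  rw [halfLaplacian]
  fin_cases l
  · fin_cases k <;> simp [peteanSymbol]
  · fin_cases k <;> simp [peteanSymbol]
  · fin_cases k <;> fin_cases i <;> fin_cases j <;> simp [peteanSymbol, planeArea, h0, h1, h2] <;> ring
  · fin_cases k <;> fin_cases i <;> fin_cases j <;> simp [peteanSymbol, planeArea, h0, h1, h2] <;> ring

theorem ricci_peteanMetric (hf : ContDiff ℝ ∞ f) (k j : Fin 4) (u : R4) : ricci (peteanMetric f) k j u = 0 := by
  simp only [ricci, riemannUp_peteanMetric hf, Fin.sum_univ_four]
  fin_cases k <;> fin_cases j <;> simp [planeArea]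

theorem weyl_peteanMetric (hf : ContDiff ℝ ∞ f) (l k i j : Fin 4) (u : R4) :
    weyl (peteanMetric f) l k i j u = planeArea l k * (-halfLaplacian f u * planeArea i j) := by
  have hr : riemannDown (peteanMetric f) l k i j u = planeArea l k * (-halfLaplacian f u * planeArea i j) := by
    simp only [riemannDown, riemannUp_peteanMetric hf, Fin.sum_univ_four]
    generalize planeArea i j = c
    fin_cases l <;> fin_cases k <;> simp [planeArea, peteanMetric]
  simp [weyl, scalarCurv, ricci_peteanMetric hf, hr]

theorem det_four (M : Matrix (Fin 4) (Fin 4) ℝ) : M.det =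
    (M 0 0 * M 1 1 - M 0 1 * M 1 0) * (M 2 2 * M 3 3 - M 2 3 * M 3 2)
      - (M 0 0 * M 1 2 - M 0 2 * M 1 0) * (M 2 1 * M 3 3 - M 2 3 * M 3 1)
      + (M 0 0 * M 1 3 - M 0 3 * M 1 0) * (M 2 1 * M 3 2 - M 2 2 * M 3 1)
      + (M 0 1 * M 1 2 - M 0 2 * M 1 1) * (M 2 0 * M 3 3 - M 2 3 * M 3 0)
      - (M 0 1 * M 1 3 - M 0 3 * M 1 1) * (M 2 0 * M 3 2 - M 2 2 * M 3 0)
      + (M 0 2 * M 1 3 - M 0 3 * M 1 2) * (M 2 0 * M 3 1 - M 2 1 * M 3 0) := by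
  simp [Matrix.det_succ_row_zero, Fin.sum_univ_succ, Fin.succAbove]
  ring

/-- By Ricci-flatness the Weyl tensor is a multiple of the square of dx₁ ∧ dx₂. Raising both indices
of dx₁ ∧ dx₂ gives ∂₃ ∧ ∂₄, and contraction with the volume form returns dx₁ ∧ dx₂. -/
theorem weylSelfDualAt_peteanMetric (hf : ContDiff ℝ ∞ f) (u : R4) : WeylSelfDualAt (peteanMetric f) u := by
  intro l k i j
  have hi : ∀ a b, ∑ c, ∑ d, (peteanMetric f u)⁻¹ a c * (peteanMetric f u)⁻¹ b d * planeArea c d =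
      !![0, 0, 0, 0; 0, 0, 0, 0; 0, 0, 0, 1; 0, 0, -1, 0] a b := by
    intro a b
    rw [inv_peteanMetric]
    fin_cases a <;> fin_cases b <;> simp [planeArea, Fin.sum_univ_four]
  have he : epsilon4 l k 2 3 - epsilon4 l k 3 2 = 2 * planeArea l k := by
    rw [epsilon4, epsilon4, det_four, det_four]
    simp only [Matrix.submatrix_apply, Matrix.one_apply]
    fin_cases l <;> fin_cases k <;> simp [planeArea] <;> norm_num
  have h1 : ∑ a, ∑ b, ∑ c, ∑ d, √(peteanMetric f u).det * epsilon4 l k a b * (peteanMetric f u)⁻¹ a c *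
      (peteanMetric f u)⁻¹ b d * weyl (peteanMetric f) c d i j u =
      ∑ a, ∑ b, epsilon4 l k a b * !![0, 0, 0, 0; 0, 0, 0, 0; 0, 0, 0, 1; 0, 0, -1, 0] a b *
        (-halfLaplacian f u * planeArea i j) := by
    refine Finset.sum_congr rfl fun a _ => Finset.sum_congr rfl fun b _ => ?_
    rw [← hi a b, det_peteanMetric, Real.sqrt_one, Finset.mul_sum, Finset.sum_mul]
    refine Finset.sum_congr rfl fun c _ => ?_
    rw [Finset.mul_sum, Finset.sum_mul]
    refine Finset.sum_congr rfl fun d _ => ?_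
    rw [weyl_peteanMetric hf]; ring
  rw [h1, weyl_peteanMetric hf]
  generalize -halfLaplacian f u * planeArea i j = c
  simp [Fin.sum_univ_four]
  linear_combination (c / 2) * he

end Petean

/-! ### Self-duality of the induced conformal structure -/

section SelfDual

variable {fp fm : ℝ × ℝ → ℝ}

theorem isConformallySelfDualOn_of_isInduced {g : FormField OGr} (hg : IsInduced fp fm g)
    (hp_smooth : ContDiff ℝ ∞ fp) (hm_smooth : ContDiff ℝ ∞ fm)
    (hp_supp : HasCompactSupport fp) (hm_supp : HasCompactSupport fm) : IsConformallySelfDualOn g S2infᶜ := by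
  -- `H` is a local model of the conformal class: a Petean metric, the negative of one, or the flat
  -- metric. Dividing by the conformal factor of `g` and by `k` turns `g` into `H` near the point.
  have key : ∀ (Q : GL (Fin 4) ℝ) (u : R4) (H : R4 → Matrix (Fin 4) (Fin 4) ℝ) (k : ℝ), 0 < k →
      0 < dirNormSq (Q.1 * affineFrame u) → (∀ᶠ w in 𝓝 u, chartMatrix fp fm Q.1 w = k • H w) → WeylSelfDualAt H u →
      ∃ e, IsPositiveChart OGr e ∧ (affineChart Q).symm u ∈ e.source ∧ ∃ h : R4 → ℝ,
        ContDiffAt ℝ ∞ h (e ((affineChart Q).symm u)) ∧ 0 < h (e ((affineChart Q).symm u)) ∧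
        WeylSelfDualAt (fun w => h w • pullbackMatrix g e.symm w) (e ((affineChart Q).symm u)) := by
    intro Q u H k hk hu hH hW
    have ht : u ∈ (affineChart Q).target := by simp [affineChart_target]
    have hpos := (hg.pullbackMatrix_eq hp_smooth hm_smooth hp_supp hm_supp Q hu).1
    refine ⟨affineChart Q, isPositiveChart_affineChart Q, (affineChart Q).map_target ht,
      fun w => (chartFactor g Q w * k)⁻¹, ?_⟩
    rw [(affineChart Q).right_inv ht]
    refine ⟨((contDiffAt_chartFactor hg.neutral Q hu).mul contDiffAt_const).inv (mul_pos hpos hk).ne',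
      inv_pos.2 (mul_pos hpos hk), hW.congr ?_⟩
    filter_upwards [hH, (isOpen_lt continuous_const (contDiff_dirNormSq Q.1).continuous).mem_nhds hu] with w hw hw'
    obtain ⟨h1, h2⟩ := hg.pullbackMatrix_eq hp_smooth hm_smooth hp_supp hm_supp Q hw'
    rw [h2, hw, smul_smul, smul_smul, mul_assoc, inv_mul_cancel₀ (mul_pos h1 hk).ne', one_smul]
  intro x hx
  obtain ⟨Q, hQ, hxQ⟩ := exists_affineChart_det_pos x
  obtain ⟨u, rfl⟩ : ∃ u, x = (affineChart Q).symm u := ⟨_, ((affineChart Q).left_inv hxQ).symm⟩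
  rw [affineChart_symm_mem_S2inf_compl] at hx
  have hA := rank_mul_affineFrame Q u
  rcases lt_trichotomy (minor (Q.1 * affineFrame u) 2 3) 0 with h | h | h
  · obtain ⟨w, hw⟩ := exists_affineChart_reflMatrix hA h
    rw [affineChart_symm_apply Q u hA, hw]
    exact key _ w _ 1 one_pos (dirNormSq_reflMatrix_pos w)
      (Eventually.of_forall fun v => by rw [one_smul, chartMatrix_reflMatrix])
      (weylSelfDualAt_peteanMetric hm_smooth.neg w).neg
  · have hd : Continuous fun w : R4 => direction (minor (Q.1 * affineFrame w)) := by
      refine continuous_pi fun k => ?_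
      fin_cases k
      exacts [(contDiff_minor Q.1 0 3).continuous, (contDiff_minor Q.1 1 3).continuous,
        (contDiff_minor Q.1 2 3).continuous]
    -- At the wall the coefficient vanishes on a neighbourhood, so the model is flat, that is,
    -- Petean with zero function.
    refine key Q u _ _ hQ hx ?_ (weylSelfDualAt_peteanMetric (f := fun _ => 0) contDiff_const u)
    filter_upwards [hd.continuousAt.eventually
      (coneCoeff_eventually_eq_zero hp_supp hm_supp (direction_ne_zero hx) h)] with w hw
    ext i j
    simp only [chartMatrix, hw, zero_mul, add_zero]
    rfl
  · obtain ⟨w, hw⟩ := exists_affineChart_one hA h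
    rw [affineChart_symm_apply Q u hA, hw]
    exact key _ w _ 1 one_pos (dirNormSq_affineFrame_pos w)
      (Eventually.of_forall fun v => by rw [one_smul]; exact chartMatrix_one fp fm v)
      (weylSelfDualAt_peteanMetric hp_smooth w)

end SelfDual

/-! ### Adapted charts and the local form along the singular sphere -/

/-- The affine chart of `Q` is centered at a plane `P ⊂ ℝ³ × {0}`: the last two columns of `Q` span `P`, the
second one is the last unit vector, and the first one is a normal vector of `P` in `ℝ³ × {0}`. -/
structure IsAdapted (Q : Matrix (Fin 4) (Fin 4) ℝ) : Prop where
  det : Q.det = 1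
  row : Q 3 = ![0, 1, 0, 0]
  col : Q 0 1 = 0 ∧ Q 1 1 = 0 ∧ Q 2 1 = 0
  orth : ∀ j : Fin 4, 2 ≤ j → Q 0 0 * Q 0 j + Q 1 0 * Q 1 j + Q 2 0 * Q 2 j = 0
  gram : 0 < (Q 0 2 ^ 2 + Q 1 2 ^ 2 + Q 2 2 ^ 2) * (Q 0 3 ^ 2 + Q 1 3 ^ 2 + Q 2 3 ^ 2) -
    (Q 0 2 * Q 0 3 + Q 1 2 * Q 1 3 + Q 2 2 * Q 2 3) ^ 2

theorem exists_isAdapted {x : OGr} (hx : x ∈ S2inf) :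
    ∃ Q : GL (Fin 4) ℝ, IsAdapted Q.1 ∧ x = (affineChart Q).symm 0 := by
  obtain ⟨A, hA, h0, h1, rfl⟩ := hx
  obtain ⟨S, hS⟩ : ∃ S, S = minor A 1 2 ^ 2 + minor A 0 2 ^ 2 + minor A 0 1 ^ 2 := ⟨_, rfl⟩
  have hS0 : 0 < S := by
    by_contra hc
    have z12 : minor A 1 2 = 0 := by nlinarith [sq_nonneg (minor A 1 2), sq_nonneg (minor A 0 2), sq_nonneg (minor A 0 1)]
    have z02 : minor A 0 2 = 0 := by nlinarith [sq_nonneg (minor A 1 2), sq_nonneg (minor A 0 2), sq_nonneg (minor A 0 1)]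
    have z01 : minor A 0 1 = 0 := by nlinarith [sq_nonneg (minor A 1 2), sq_nonneg (minor A 0 2), sq_nonneg (minor A 0 1)]
    obtain ⟨i, j, hij⟩ := exists_minor_ne_zero hA
    simp only [minor] at z12 z02 z01 hij
    refine hij ?_
    fin_cases i <;> fin_cases j <;> simp [h0, h1] <;> linarith
  -- The first column is the cross product of the columns of `A` divided by its squared length `S`,
  -- which makes the determinant 1. By Lagrange's identity the Gram determinant of the last two
  -- columns is `S`.
  let Q : Matrix (Fin 4) (Fin 4) ℝ := !![minor A 1 2 / S, 0, A 0 0, A 0 1; -minor A 0 2 / S, 0, A 1 0, A 1 1;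
    minor A 0 1 / S, 0, A 2 0, A 2 1; 0, 1, 0, 0]
  have hd : Q.det = 1 := by
    rw [det_four]
    simp [Q]
    field_simp
    rw [hS]
    simp only [minor]
    ring
  refine ⟨Matrix.GeneralLinearGroup.mkOfDetNeZero Q (by rw [hd]; exact one_ne_zero), ⟨hd, ?_, ?_, ?_, ?_⟩, ?_⟩
  · ext j; fin_cases j <;> rfl
  · exact ⟨rfl, rfl, rfl⟩
  · intro j hj
    change Q 0 0 * Q 0 j + Q 1 0 * Q 1 j + Q 2 0 * Q 2 j = 0
    fin_cases j
    · simp at hj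
    · simp at hj
    · simp [Q, minor]; field_simp; ring
    · simp [Q, minor]; field_simp; ring
  · change 0 < (Q 0 2 ^ 2 + Q 1 2 ^ 2 + Q 2 2 ^ 2) * (Q 0 3 ^ 2 + Q 1 3 ^ 2 + Q 2 3 ^ 2) -
      (Q 0 2 * Q 0 3 + Q 1 2 * Q 1 3 + Q 2 2 * Q 2 3) ^ 2
    have : (Q 0 2 ^ 2 + Q 1 2 ^ 2 + Q 2 2 ^ 2) * (Q 0 3 ^ 2 + Q 1 3 ^ 2 + Q 2 3 ^ 2) -
      (Q 0 2 * Q 0 3 + Q 1 2 * Q 1 3 + Q 2 2 * Q 2 3) ^ 2 = S := by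
      rw [hS]; simp [Q, minor]; ring
    rwa [this]
  · have h : A = Q * affineFrame 0 := by
      ext i j
      fin_cases j
      · change A i 0 = (Q * affineFrame 0) i 0
        rw [mul_affineFrame_zero]; fin_cases i <;> simp [Q, h0]
      · change A i 1 = (Q * affineFrame 0) i 1
        rw [mul_affineFrame_one]; fin_cases i <;> simp [Q, h1]
    exact congrArg (Quotient.mk frameSetoid) (Subtype.ext h)

section Adapted

variable {Q : Matrix (Fin 4) (Fin 4) ℝ}

theorem IsAdapted.last_row (hQ : IsAdapted Q) (u : R4) :
    (Q * affineFrame u) 3 0 = u 1 ∧ (Q * affineFrame u) 3 1 = u 2 := by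
  rw [mul_affineFrame_zero, mul_affineFrame_one, hQ.row]; simp

/-- The factors of the components of the Petean terms that vanish along the singular surface. -/
def radialFactor (u : R4) (i : Fin 4) : ℝ := ![u 2, u 2, -u 1, u 1] i

/-- The part of the components of the Petean terms that vanishes along the singular surface after division
by the radial factors. -/
def smallFactor (Q : Matrix (Fin 4) (Fin 4) ℝ) (u : R4) (k : Fin 4) : ℝ :=
  minor (Q * affineFrame u) 2 3 * Q k 0 - minor (Q * affineFrame u) k 3 * Q 2 0

/-- The vector whose componentwise product with the radial factors gives the Petean terms, where `s` stands
for the small factor. -/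
def angularVec (Q : Matrix (Fin 4) (Fin 4) ℝ) (u : R4) (k : Fin 4) (s : ℝ) (i : Fin 4) : ℝ :=
  ![s, minor (Q * affineFrame u) k 2, minor (Q * affineFrame u) k 2, s] i

/-- The components 1 and 2 together form minus the minor of the rows `k`, 2 times r² dφ. The other
two contain `smallFactor`, which vanishes on the surface, and contribute only to the error. -/
theorem IsAdapted.quotDiff_eq (hQ : IsAdapted Q) (u : R4) (i : Fin 4) {k : Fin 4} (hk : k = 0 ∨ k = 1) :
    quotDiff (minor (Q * affineFrame u)) (dMinor Q u i) k =
      radialFactor u i * angularVec Q u k (smallFactor Q u k) i := by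
  obtain ⟨c0, c1, c2⟩ := hQ.col
  obtain ⟨e0, e1⟩ := hQ.last_row u
  have r0 : Q 3 0 = 0 := by rw [hQ.row]; rfl
  have r1 : Q 3 1 = 1 := by rw [hQ.row]; rfl
  have ck : Q k 1 = 0 := by rcases hk with rfl | rfl <;> assumption
  simp only [quotDiff, dMinor, minor, radialFactor, angularVec, smallFactor, e0, e1]
  generalize Q * affineFrame u = N
  fin_cases i <;> simp [r0, r1, c2, ck] <;> ring

/-- Orthogonality of the normal column splits |T|² into a nonnegative square and a positive definite
binary form in `u 1`, `u 2`. The least eigenvalue of that form is at least its determinant over its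
trace. -/
theorem IsAdapted.dirNormSq_ge (hQ : IsAdapted Q) : ∃ C, ∀ u : R4,
    u 1 ^ 2 + u 2 ^ 2 ≤ C * dirNormSq (Q * affineFrame u) := by
  obtain ⟨A, hA⟩ : ∃ A, A = Q 0 2 ^ 2 + Q 1 2 ^ 2 + Q 2 2 ^ 2 := ⟨_, rfl⟩
  obtain ⟨B, hB⟩ : ∃ B, B = Q 0 2 * Q 0 3 + Q 1 2 * Q 1 3 + Q 2 2 * Q 2 3 := ⟨_, rfl⟩
  obtain ⟨C, hC⟩ : ∃ C, C = Q 0 3 ^ 2 + Q 1 3 ^ 2 + Q 2 3 ^ 2 := ⟨_, rfl⟩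
  have hD := hQ.gram
  rw [← hA, ← hB, ← hC] at hD
  have hA0 : 0 ≤ A := by rw [hA]; positivity
  have hC0 : 0 ≤ C := by rw [hC]; positivity
  refine ⟨(A + C) / (A * C - B ^ 2), fun u => ?_⟩
  obtain ⟨c0, c1, c2⟩ := hQ.col
  obtain ⟨e0, e1⟩ := hQ.last_row u
  have o2 := hQ.orth 2 le_rfl
  have o3 := hQ.orth 3 (by decide)
  obtain ⟨w, hw⟩ : ∃ w, w = u 0 * u 2 + u 3 * u 1 := ⟨_, rfl⟩
  have hN : dirNormSq (Q * affineFrame u) = (Q 0 0 ^ 2 + Q 1 0 ^ 2 + Q 2 0 ^ 2) * w ^ 2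
      + (A * u 2 ^ 2 - 2 * B * (u 1 * u 2) + C * u 1 ^ 2) := by
    simp only [dirNormSq, minor, e0, e1]
    simp only [mul_affineFrame_zero, mul_affineFrame_one, c0, c1, c2]
    rw [hA, hB, hC, hw]
    linear_combination (2 * u 2 * (u 0 * u 2 + u 3 * u 1)) * o2 - (2 * u 1 * (u 0 * u 2 + u 3 * u 1)) * o3
  rw [div_mul_eq_mul_div, le_div_iff₀ hD, hN]
  have h1 : 0 ≤ (A + C) * ((Q 0 0 ^ 2 + Q 1 0 ^ 2 + Q 2 0 ^ 2) * w ^ 2) := by positivity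
  -- Trace times form minus determinant times `u 1 ^ 2 + u 2 ^ 2` is the sum of these two squares.
  nlinarith [sq_nonneg (A * u 2 - B * u 1), sq_nonneg (C * u 1 - B * u 2)]

theorem IsAdapted.dirNormSq_pos (hQ : IsAdapted Q) {u : R4} (hu : 0 < u 1 ^ 2 + u 2 ^ 2) :
    0 < dirNormSq (Q * affineFrame u) := by
  obtain ⟨C, hC⟩ := hQ.dirNormSq_ge
  have h0 : 0 ≤ dirNormSq (Q * affineFrame u) := by rw [dirNormSq]; positivity
  refine h0.lt_of_ne fun h => ?_
  have := hC u
  rw [← h, mul_zero] at this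
  linarith

/-- The coefficient of `r² dφ²` in the local form of the induced conformal structure. -/
def angularCoeff (fp fm : ℝ × ℝ → ℝ) (Q : Matrix (Fin 4) (Fin 4) ℝ) (p : ℝ × ℝ × ℝ) : ℝ :=
  coneCoeff fp fm (direction (minor (Q * affineFrame ![p.1, Real.cos p.2.2, Real.sin p.2.2, p.2.1]))) *
    (minor (Q * affineFrame ![p.1, Real.cos p.2.2, Real.sin p.2.2, p.2.1]) 0 2 ^ 2 +
      minor (Q * affineFrame ![p.1, Real.cos p.2.2, Real.sin p.2.2, p.2.1]) 1 2 ^ 2)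

/-- The error term in the local form of the induced conformal structure. -/
def errorMatrix (fp fm : ℝ × ℝ → ℝ) (Q : Matrix (Fin 4) (Fin 4) ℝ) (u : R4) : Matrix (Fin 4) (Fin 4) ℝ := Matrix.of fun i j =>
  coneCoeff fp fm (direction (minor (Q * affineFrame u))) * (radialFactor u i * radialFactor u j) *
    ((angularVec Q u 0 (smallFactor Q u 0) i * angularVec Q u 0 (smallFactor Q u 0) j -
        angularVec Q u 0 0 i * angularVec Q u 0 0 j) +
      (angularVec Q u 1 (smallFactor Q u 1) i * angularVec Q u 1 (smallFactor Q u 1) j -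
        angularVec Q u 1 0 i * angularVec Q u 1 0 j))

variable {fp fm : ℝ × ℝ → ℝ}

/-- Setting the small factors to zero leaves squares of multiples of r² dφ. The coefficient has
degree -2 in `r`, so the leading term is r² dφ² times a function evaluated at the point `w` with r =
1. -/
theorem IsAdapted.chartMatrix_eq (hQ : IsAdapted Q) {a d r φ : ℝ} (hr : 0 < r) :
    chartMatrix fp fm Q ![a, r * Real.cos φ, r * Real.sin φ, d] = stdNeutral +
      angularCoeff fp fm Q (a, d, φ) • angularForm φ +
      errorMatrix fp fm Q ![a, r * Real.cos φ, r * Real.sin φ, d] := by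
  obtain ⟨c0, c1, c2⟩ := hQ.col
  set u : R4 := ![a, r * Real.cos φ, r * Real.sin φ, d] with hu
  set w : R4 := ![a, Real.cos φ, Real.sin φ, d] with hw
  have hT : direction (minor (Q * affineFrame u)) = r • direction (minor (Q * affineFrame w)) := by
    obtain ⟨e0, e1⟩ := hQ.last_row u
    obtain ⟨f0, f1⟩ := hQ.last_row w
    ext k
    fin_cases k <;>
      simp only [direction, minor, e0, e1, f0, f1, mul_affineFrame_zero, mul_affineFrame_one, c0, c1, c2] <;>
      simp [hu, hw] <;> ring
  -- In an adapted chart these minors depend only on the first and last coordinates.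
  have hβ : ∀ k, k = 0 ∨ k = 1 → minor (Q * affineFrame u) k 2 = minor (Q * affineFrame w) k 2 := by
    intro k hk
    have ck : Q k 1 = 0 := by rcases hk with rfl | rfl <;> assumption
    simp [minor, mul_affineFrame_zero, mul_affineFrame_one, ck, c2, hu, hw]
  have hβ0 := hβ 0 (Or.inl rfl)
  have hβ1 := hβ 1 (Or.inr rfl)
  ext i j
  simp only [chartMatrix, errorMatrix, angularCoeff, ← hw, hQ.det, one_mul, hQ.quotDiff_eq u _ (Or.inl rfl),
    hQ.quotDiff_eq u _ (Or.inr rfl), Matrix.of_apply, Matrix.add_apply, Matrix.smul_apply, smul_eq_mul, hT,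
    coneCoeff_smul fp fm hr]
  generalize coneCoeff fp fm _ = K
  have key : K / r ^ 2 * (radialFactor u i * radialFactor u j) *
      (angularVec Q u 0 0 i * angularVec Q u 0 0 j + angularVec Q u 1 0 i * angularVec Q u 1 0 j) =
      K * (minor (Q * affineFrame w) 0 2 ^ 2 + minor (Q * affineFrame w) 1 2 ^ 2) * angularForm φ i j := by
    simp only [angularVec, hβ0, hβ1, angularForm, Matrix.vecMulVec_apply]
    generalize minor (Q * affineFrame w) 0 2 = x
    generalize minor (Q * affineFrame w) 1 2 = y
    fin_cases i <;> fin_cases j <;> simp [radialFactor, hu] <;> field_simp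
  rw [← key]
  ring

theorem abs_radialFactor_mul_le (u : R4) (i j : Fin 4) :
    |radialFactor u i * radialFactor u j| ≤ u 1 ^ 2 + u 2 ^ 2 := by
  have h : ∀ i, radialFactor u i ^ 2 ≤ u 1 ^ 2 + u 2 ^ 2 := by
    intro i; fin_cases i <;> simp [radialFactor] <;> positivity
  rw [abs_le]
  constructor <;>
    nlinarith [h i, h j, sq_nonneg (radialFactor u i + radialFactor u j),
      sq_nonneg (radialFactor u i - radialFactor u j)]

/-- The coefficient is at most a constant over |T|², and the radial factors contribute at most r²,
itself at most a constant times |T|². Their product is bounded, and the remaining factor is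
continuous and vanishes on the surface. -/
theorem IsAdapted.tendsto_errorMatrix (hQ : IsAdapted Q) (hp_smooth : ContDiff ℝ ∞ fp)
    (hm_smooth : ContDiff ℝ ∞ fm) (hp_supp : HasCompactSupport fp) (hm_supp : HasCompactSupport fm) {p : R4}
    (h1 : p 1 = 0) (h2 : p 2 = 0) : Tendsto (errorMatrix fp fm Q) (𝓝 p) (𝓝 0) := by
  obtain ⟨C, hC⟩ := exists_coneCoeff_bound hp_smooth hm_smooth hp_supp hm_supp
  obtain ⟨D, hD⟩ := hQ.dirNormSq_ge
  have hs : ∀ k, k = 0 ∨ k = 1 → smallFactor Q p k = 0 := by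
    obtain ⟨e0, e1⟩ := hQ.last_row p
    intro k _
    simp [smallFactor, minor, e0, e1, h1, h2]
  have hsc : ∀ k, Continuous fun u => smallFactor Q u k := fun k =>
    ((contDiff_minor Q 2 3).continuous.mul continuous_const).sub
      ((contDiff_minor Q k 3).continuous.mul continuous_const)
  have hvc : ∀ k i (s : R4 → ℝ), Continuous s → Continuous fun u => angularVec Q u k (s u) i := by
    intro k i s hs
    have := (contDiff_minor Q k 2).continuous
    fin_cases i
    exacts [hs, this, this, hs]
  refine tendsto_pi_nhds.2 fun i => tendsto_pi_nhds.2 fun j => ?_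
  refine bdd_le_mul_tendsto_zero' (|D| * C) (Eventually.of_forall fun u => ?_) ?_
  · set K := coneCoeff fp fm (direction (minor (Q * affineFrame u)))
    have hN0 : 0 ≤ dirNormSq (Q * affineFrame u) := by rw [dirNormSq]; positivity
    have hKN : |K| * dirNormSq (Q * affineFrame u) ≤ C := hC (direction (minor (Q * affineFrame u)))
    rw [abs_mul]
    calc |K| * |radialFactor u i * radialFactor u j|
        ≤ |K| * (|D| * dirNormSq (Q * affineFrame u)) := by
          gcongr
          exact (abs_radialFactor_mul_le u i j).trans ((hD u).trans (by gcongr; exact le_abs_self D))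
      _ = |D| * (|K| * dirNormSq (Q * affineFrame u)) := by ring
      _ ≤ |D| * C := by gcongr
  · have hc : Continuous fun u => (angularVec Q u 0 (smallFactor Q u 0) i * angularVec Q u 0 (smallFactor Q u 0) j -
        angularVec Q u 0 0 i * angularVec Q u 0 0 j) +
      (angularVec Q u 1 (smallFactor Q u 1) i * angularVec Q u 1 (smallFactor Q u 1) j -
        angularVec Q u 1 0 i * angularVec Q u 1 0 j) := by
      have v := fun k i => hvc k i _ (hsc k)
      have z := fun k i => hvc k i (fun _ => 0) continuous_const
      exact (((v 0 i).mul (v 0 j)).sub ((z 0 i).mul (z 0 j))).add (((v 1 i).mul (v 1 j)).sub ((z 1 i).mul (z 1 j)))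
    have := hc.tendsto p
    rwa [hs 0 (Or.inl rfl), hs 1 (Or.inr rfl), sub_self, sub_self, add_zero] at this

theorem IsAdapted.contDiff_angularCoeff (hQ : IsAdapted Q) (hp_smooth : ContDiff ℝ ∞ fp)
    (hm_smooth : ContDiff ℝ ∞ fm) (hp_supp : HasCompactSupport fp) (hm_supp : HasCompactSupport fm) :
    ContDiff ℝ ∞ (angularCoeff fp fm Q) := by
  rw [contDiff_iff_contDiffAt]
  intro p
  have hc : ContDiff ℝ ∞ fun p : ℝ × ℝ × ℝ => (![p.1, Real.cos p.2.2, Real.sin p.2.2, p.2.1] : R4) := by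
    refine contDiff_pi.2 fun k => ?_
    fin_cases k <;> simp <;> fun_prop
  -- The circle r = 1 avoids the singular sphere, so the coefficient is smooth there for all values
  -- of the parameters.
  have hN : 0 < dirNormSq (Q * affineFrame ![p.1, Real.cos p.2.2, Real.sin p.2.2, p.2.1]) :=
    hQ.dirNormSq_pos (by simp)
  have hK := ContDiffAt.comp (f := fun p : ℝ × ℝ × ℝ => (![p.1, Real.cos p.2.2, Real.sin p.2.2, p.2.1] : R4)) p
    (contDiffAt_coneCoeff_direction hp_smooth hm_smooth hp_supp hm_supp Q hN) hc.contDiffAt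
  exact hK.mul ((((contDiff_minor Q 0 2).comp hc).pow 2).add (((contDiff_minor Q 1 2).comp hc).pow 2)).contDiffAt

end Adapted

theorem isSingularNeutral_of_isInduced {fp fm : ℝ × ℝ → ℝ} {g : FormField OGr} (hg : IsInduced fp fm g)
    (hp_smooth : ContDiff ℝ ∞ fp) (hm_smooth : ContDiff ℝ ∞ fm)
    (hp_supp : HasCompactSupport fp) (hm_supp : HasCompactSupport fm) : IsSingularNeutral S2inf g := by
  refine ⟨isClosed_S2inf, TS2_eq_compl ▸ hg.neutral, fun x hx => ?_⟩
  obtain ⟨Q, hQ, rfl⟩ := exists_isAdapted hx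
  have ht : ∀ u, u ∈ (affineChart Q).target := fun u => by simp [affineChart_target]
  have hmem : ∀ u, (affineChart Q).symm u ∈ S2inf ↔ u 1 = 0 ∧ u 2 = 0 := by
    intro u
    rw [affineChart_symm_apply Q u (rank_mul_affineFrame Q u), mk_mem_S2inf, (hQ.last_row u).1, (hQ.last_row u).2]
  refine ⟨affineChart Q, isPositiveChart_affineChart Q, (affineChart Q).map_target (ht 0), fun u _ => hmem u,
    fun u => (chartFactor g Q u)⁻¹, angularCoeff fp fm Q.1, errorMatrix fp fm Q.1, ?_, ?_, ?_, ?_, ?_⟩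
  · rintro u ⟨-, hu⟩
    have hN := (affineChart_symm_mem_S2inf_compl Q u).1 hu
    have h := hg.pullbackMatrix_eq hp_smooth hm_smooth hp_supp hm_supp Q hN
    exact ((contDiffAt_chartFactor hg.neutral Q hN).inv h.1.ne').contDiffWithinAt
  · intro u _ hu
    have hN := (affineChart_symm_mem_S2inf_compl Q u).1 hu
    exact inv_pos.2 (hg.pullbackMatrix_eq hp_smooth hm_smooth hp_supp hm_supp Q hN).1
  · exact (hQ.contDiff_angularCoeff hp_smooth hm_smooth hp_supp hm_supp).contDiffOn
  · intro a d r φ hr _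
    have hN : 0 < dirNormSq (Q.1 * affineFrame ![a, r * Real.cos φ, r * Real.sin φ, d]) := by
      refine hQ.dirNormSq_pos ?_
      have : (r * Real.cos φ) ^ 2 + (r * Real.sin φ) ^ 2 = r ^ 2 := by
        linear_combination r ^ 2 * Real.cos_sq_add_sin_sq φ
      change 0 < (r * Real.cos φ) ^ 2 + (r * Real.sin φ) ^ 2
      rw [this]; positivity
    obtain ⟨h1, h2⟩ := hg.pullbackMatrix_eq hp_smooth hm_smooth hp_supp hm_supp Q hN
    rw [h2, smul_smul, inv_mul_cancel₀ h1.ne', one_smul, hQ.chartMatrix_eq hr]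
  · intro p _ hp
    obtain ⟨h1, h2⟩ := (hmem p).1 hp
    exact (hQ.tendsto_errorMatrix hp_smooth hm_smooth hp_supp hm_supp h1 h2).mono_left nhdsWithin_le_nhds

end

theorem mainTheorem7 (fp fm : ℝ × ℝ → ℝ)
    (hp_smooth : ContDiff ℝ ∞ fp) (hm_smooth : ContDiff ℝ ∞ fm)
    (hp_supp : HasCompactSupport fp) (hm_supp : HasCompactSupport fm)
    (hp_axi : IsAxisymmetric fp) (hm_axi : IsAxisymmetric fm)
    (h_dual : ∀ p, fm p = - fp p) :
    TS2 = S2infᶜ ∧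
    (∃ g : FormField OGr, IsInduced fp fm g) ∧
    ∀ g : FormField OGr, IsInduced fp fm g →
      IsConformallySelfDualOn g S2infᶜ ∧ IsSingularNeutral S2inf g :=
  ⟨TS2_eq_compl, ⟨_, isInduced_inducedMetric hp_smooth hm_smooth hp_supp hm_supp⟩, fun _ hg =>
    ⟨isConformallySelfDualOn_of_isInduced hg hp_smooth hm_smooth hp_supp hm_supp,
      isSingularNeutral_of_isInduced hg hp_smooth hm_smooth hp_supp hm_supp⟩⟩
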